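/- Let $A\in\mathbb R^{M\times N}$, $M\ge N\ge 2$, have the singular value decomposition $A=U\Sigma V^T$ with $U=[u_1,\dots,u_M]$ and $V=[v_1,\dots,v_N]$ orthogonal and $\Sigma=\mathrm{diag}\{\sigma_1,\dots,\sigma_N\}\in\mathbb R^{M\times N}$, $\sigma_i\ge 0$. Let $\tau\ge 0$ differ from every singular value of $A$, and let the singular values be labeled so that $|\sigma_1-\tau|<|\sigma_2-\tau|\le\dots\le|\sigma_N-\tau|$. Let $\sigma_{\max},\sigma_{\max,2},\sigma_{\min},\sigma_{\min,2}$ be the largest, second largest, smallest and second smallest singular values of $A$, counted with multiplicity, and let $\|\cdot\|$ be the 2-norm. Let $\tilde u_1\in\mathbb R^M$ and $\tilde v_1\in\mathbb R^N$ be unit vectors, let $\phi,\psi\in[0,\pi/2]$ be the acute angles between $\tilde u_1$ and $u_1$ and between $\tilde v_1$ and $v_1$, and let $r\in\mathbb R^{M+N}$ be a nonzero vector whose upper part (in $\mathbb R^M$) is orthogonal to $\tilde u_1$ and whose lower part (in $\mathbb R^N$) is orthogonal to $\tilde v_1$; for example, $r$ may be the residual $\begin{bmatrix}A\tilde v_1-\theta_1\tilde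 u_1\\A^T\tilde u_1-\theta_1\tilde v_1\end{bmatrix}\neq 0$ of a Ritz approximation $(\theta_1,\tilde u_1,\tilde v_1)$ of $(\sigma_1,u_1,v_1)$ given by the standard extraction. Consider the JDSVD correction equation $\widetilde B_1w=-r$ with $$\widetilde B_1=\begin{bmatrix}I-\tilde u_1\tilde u_1^T&\\&I-\tilde v_1\tilde v_1^T\end{bmatrix}\begin{bmatrix}-\tau I&A\\A^T&-\tau I\end{bmatrix}\begin{bmatrix}I-\tilde u_1\tilde u_1^T&\\&I-\tilde v_1\tilde v_1^T\end{bmatrix}.$$ For $j\ge0$, let $\tilde w_j$ be its $j$th MINRES approximation with zero initial guess, that is, a minimizer of $\|\widetilde B_1\tilde w+r\|$ over $\tilde w\in\mathrm{span}\{r,\widetilde B_1r,\dots,\widetilde B_1^{j-1}r\}$, and let $r_{\mathrm{in},j}=\widetilde B_1\tilde w_j+r$. Suppose that $$\delta:=\|A\|(\sin\phi+\sin\psi)^2<|\sigma_2-\tau|.$$ Then for all $j\ge 0$, with $[x]$ denoting the integer part of $x$ (rounded towards zero) and $x^0=1$: (i) if $\sigma_1=\sigma_{\max}$, then $$\frac{\|r_{\mathrm{in},j}\|}{\|r\|}\le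 2\left(1-\frac{2}{1+\sqrt{(\tau+\sigma_{\max,2}+\delta)/(\tau-\sigma_{\max,2}-\delta)}}\right)^{j};$$ (ii) if $\sigma_1=\sigma_{\min}$, and $\tau>0$ or $M=N$, then with $j_o=\min\{1,M-N\}$, $$\frac{\|r_{\mathrm{in},j}\|}{\|r\|}\le 2\left(\frac{\sigma_{\max}+\delta}{\tau}\right)^{j_o}\left(1-\frac{2}{1+\sqrt{\frac{(\sigma_{\max}+\delta)^2-\tau^2}{(\sigma_{\min,2}-\delta)^2-\tau^2}}}\right)^{\left[\frac{j-j_o}{2}\right]}$$ (for $j_o=0$ the factor $\left(\frac{\sigma_{\max}+\delta}{\tau}\right)^{j_o}$ is $1$, also when $\tau=0$); (iii) if $\sigma_1\neq\sigma_{\max}$ and $\sigma_1\neq\sigma_{\min}$, then $$\frac{\|r_{\mathrm{in},j}\|}{\|r\|}\le 2\left(1-\frac{2}{1+(\sigma_{\max}+\tau+\delta)/(|\sigma_2-\tau|-\delta)}\right)^{\left[\frac{j}{2}\right]}.$$ -/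

import Mathlib

open scoped Matrix.Norms.L2Operator

noncomputable section

namespace JDSVD

variable {M N : ℕ}

/-- The `M × N` matrix `Σ = diag{σ_1, …, σ_N}`. -/
def rectDiagonal (M : ℕ) (σ : Fin N → ℝ) : Matrix (Fin M) (Fin N) ℝ :=
  Matrix.of fun i j => if (i : ℕ) = (j : ℕ) then σ j else 0

/-- `A = U Σ Vᵀ` is a singular value decomposition of `A`, the singular values `σ_1, …, σ_N`
being listed with multiplicity and in an arbitrary order. -/
structure IsSVD (A : Matrix (Fin M) (Fin N) ℝ) (U : Matrix (Fin M) (Fin M) ℝ)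
    (σ : Fin N → ℝ) (V : Matrix (Fin N) (Fin N) ℝ) : Prop where
  left_orthogonal : U ∈ Matrix.orthogonalGroup (Fin M) ℝ
  right_orthogonal : V ∈ Matrix.orthogonalGroup (Fin N) ℝ
  nonneg : ∀ i, 0 ≤ σ i
  eq : A = U * rectDiagonal M σ * V.transpose

/-- The values of `σ`, with multiplicity, in ascending order. -/
def ascending (σ : Fin N → ℝ) : Fin N → ℝ := σ ∘ Tuple.sort σ

/-- The largest singular value. -/
def sigmaMax (hN : 2 ≤ N) (σ : Fin N → ℝ) : ℝ := ascending σ ⟨N - 1, by omega⟩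

/-- The second largest singular value. -/
def sigmaMax2 (hN : 2 ≤ N) (σ : Fin N → ℝ) : ℝ := ascending σ ⟨N - 2, by omega⟩

/-- The smallest singular value. -/
def sigmaMin (hN : 2 ≤ N) (σ : Fin N → ℝ) : ℝ := ascending σ ⟨0, by omega⟩

/-- The second smallest singular value. -/
def sigmaMin2 (hN : 2 ≤ N) (σ : Fin N → ℝ) : ℝ := ascending σ ⟨1, by omega⟩

/-- The `i`-th column of a square matrix, as a Euclidean vector. -/
def column {n : ℕ} (U : Matrix (Fin n) (Fin n) ℝ) (i : Fin n) : EuclideanSpace ℝ (Fin n) :=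
  WithLp.toLp 2 fun k => U k i

/-- The acute angle (in `[0, π/2]`) between the lines spanned by two nonzero vectors. -/
def acuteAngle {n : ℕ} (x y : EuclideanSpace ℝ (Fin n)) : ℝ :=
  Real.arccos (|inner ℝ x y| / (‖x‖ * ‖y‖))

/-- The symmetric matrix `[[-τ I, A], [Aᵀ, -τ I]]`. -/
def augmented (A : Matrix (Fin M) (Fin N) ℝ) (τ : ℝ) :
    Matrix (Fin M ⊕ Fin N) (Fin M ⊕ Fin N) ℝ :=
  Matrix.fromBlocks (-τ • 1) A A.transpose (-τ • 1)

/-- The matrix `diag(I - u uᵀ, I - v vᵀ)`. -/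
def projector (u : EuclideanSpace ℝ (Fin M)) (v : EuclideanSpace ℝ (Fin N)) :
    Matrix (Fin M ⊕ Fin N) (Fin M ⊕ Fin N) ℝ :=
  Matrix.fromBlocks (1 - Matrix.vecMulVec u.ofLp u.ofLp) 0 0
    (1 - Matrix.vecMulVec v.ofLp v.ofLp)

/-- The coefficient matrix of the JDSVD correction equation. -/
def correctionMatrix (A : Matrix (Fin M) (Fin N) ℝ) (τ : ℝ)
    (u : EuclideanSpace ℝ (Fin M)) (v : EuclideanSpace ℝ (Fin N)) :
    Matrix (Fin M ⊕ Fin N) (Fin M ⊕ Fin N) ℝ :=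
  projector u v * augmented A τ * projector u v

/-- `r ⊥⊥ (u, v)`: the upper part of `r` is orthogonal to `u`, the lower part to `v`. -/
def BiPerp (r : EuclideanSpace ℝ (Fin M ⊕ Fin N))
    (u : EuclideanSpace ℝ (Fin M)) (v : EuclideanSpace ℝ (Fin N)) : Prop :=
  ∑ i, r (Sum.inl i) * u i = 0 ∧ ∑ j, r (Sum.inr j) * v j = 0

/-- The residual `(A v - θ u, Aᵀ u - θ v)` of an approximate singular triplet `(θ, u, v)`. -/
def residual (A : Matrix (Fin M) (Fin N) ℝ) (θ : ℝ)
    (u : EuclideanSpace ℝ (Fin M)) (v : EuclideanSpace ℝ (Fin N)) :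
    EuclideanSpace ℝ (Fin M ⊕ Fin N) :=
  WithLp.toLp 2 (Sum.elim (fun i => (A.mulVec v.ofLp) i - θ * u i)
    (fun j => (A.transpose.mulVec u.ofLp) j - θ * v j))

/-- The residual of a Ritz approximation with respect to searching subspaces `𝒰`, `𝒱` is doubly
orthogonal to the Ritz vectors, so it is one of the right-hand sides considered below. -/
theorem biPerp_residual (A : Matrix (Fin M) (Fin N) ℝ) (θ : ℝ)
    (u : EuclideanSpace ℝ (Fin M)) (v : EuclideanSpace ℝ (Fin N))
    (𝒰 : Submodule ℝ (EuclideanSpace ℝ (Fin M))) (𝒱 : Submodule ℝ (EuclideanSpace ℝ (Fin N)))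
    (hu : u ∈ 𝒰) (hv : v ∈ 𝒱)
    (h𝒰 : ∀ x ∈ 𝒰, ∑ i, residual A θ u v (Sum.inl i) * x i = 0)
    (h𝒱 : ∀ y ∈ 𝒱, ∑ j, residual A θ u v (Sum.inr j) * y j = 0) :
    BiPerp (residual A θ u v) u v :=
  ⟨h𝒰 u hu, h𝒱 v hv⟩

/-- The Krylov subspace `span{b, C b, …, C^(j-1) b}`. -/
def krylov {ι : Type*} [Fintype ι] [DecidableEq ι] (C : Matrix ι ι ℝ)
    (b : EuclideanSpace ℝ ι) (j : ℕ) : Submodule ℝ (EuclideanSpace ℝ ι) :=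
  Submodule.span ℝ (Set.range fun i : Fin j => Matrix.toEuclideanLin (C ^ (i : ℕ)) b)

/-- `x` is the `j`-th MINRES approximation for the symmetric system `C x = b` with zero initial
guess: it minimizes the residual norm over the `j`-th Krylov subspace. -/
def IsMinresIterate {ι : Type*} [Fintype ι] [DecidableEq ι] (C : Matrix ι ι ℝ)
    (b : EuclideanSpace ℝ ι) (j : ℕ) (x : EuclideanSpace ℝ ι) : Prop :=
  x ∈ krylov C b j ∧
    ∀ y ∈ krylov C b j, ‖b - Matrix.toEuclideanLin C x‖ ≤ ‖b - Matrix.toEuclideanLin C y‖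

/-- The inner residual `r_in = B̃₁ w + r` of an approximate solution `w` of the correction
equation `B̃₁ w = -r`. -/
def innerResidual (A : Matrix (Fin M) (Fin N) ℝ) (τ : ℝ)
    (u : EuclideanSpace ℝ (Fin M)) (v : EuclideanSpace ℝ (Fin N))
    (r w : EuclideanSpace ℝ (Fin M ⊕ Fin N)) : EuclideanSpace ℝ (Fin M ⊕ Fin N) :=
  Matrix.toEuclideanLin (correctionMatrix A τ u v) w + r

end JDSVD

end

noncomputable section

namespace JDSVD

open Polynomial

/-! The vector `r` lies in the subspace of vectors doubly orthogonal to `u`, `v`. It is invariant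
under the symmetric correction matrix, so the MINRES residual is at most `‖r‖` times the maximum of
`|p|` over the eigenvalues on that subspace, for any `p` of degree at most `j` with `p(0) = 1`
(`norm_innerResidual_div_le`). It remains to locate these eigenvalues and to choose `p`.

Write an eigenvalue as `μ - τ`; then `μ` is an eigenvalue of the compression of `[[0, A], [Aᵀ, 0]]`
to the complements of `u` and `v`. Rotating these complements isometrically onto those of the exact
vectors `u₁`, `v₁` changes the compression by at most `δ`: since `u₁`, `v₁` are singular vectors,
all terms linear in the sines vanish (`abs_inner_rotate_sub_le`). An eigenvector thus gives an
approximate singular triplet `(μ, y, z)` of `A`, orthogonal to `u₁`, `v₁`, with residuals at most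
`δ‖z‖` and `δ‖y‖` (`exists_approx_of_eigenvector`). Expansion in singular vectors, with `σ₁`
removed, then bounds `|μ|` from above and below, or `|μ - τ|` from below.

The polynomials are scaled Chebyshev polynomials (`exists_residual_polynomial`): directly in `t = μ
- τ` when the spectrum is on one side of zero; in `μ² - τ²` when `σ₁` is smallest, with an extra
factor `μ / τ` to annihilate the possible value `μ = 0` if `M > N`; in `t²` for an interior `σ₁`. -/

/-! ### Chebyshev residual polynomials on an interval -/

theorem eval_chebyshev_T_joukowski (k : ℕ) {ρ : ℝ} (hρ : ρ ≠ 0) :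
    (Chebyshev.T ℝ k).eval ((ρ + ρ⁻¹) / 2) = (ρ ^ k + ρ⁻¹ ^ k) / 2 := by
  induction k using Nat.twoStepInduction with
  | zero => simp
  | one => simp
  | more n h1 h2 =>
    push_cast at h2 ⊢
    rw [Chebyshev.T_add_two]
    simp only [eval_sub, eval_mul, eval_X, eval_ofNat, h1, h2]
    linear_combination ((ρ ^ n + ρ⁻¹ ^ n) / 2) * mul_inv_cancel₀ hρ

/-- The shifted and scaled Chebyshev polynomial behind the convergence bound of the conjugate
gradient and the minimal residual methods. -/
theorem exists_residual_polynomial (k : ℕ) {a b : ℝ} (ha : 0 < a) (hab : a ≤ b) :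
    ∃ q : ℝ[X], q.natDegree ≤ k ∧ q.eval 0 = 1 ∧
      ∀ t, a ≤ t → t ≤ b → |q.eval t| ≤ 2 * (1 - 2 / (1 + √(b / a))) ^ k := by
  rcases hab.eq_or_lt with rfl | hlt
  -- On a one-point interval the rate is `0`, so the polynomial must vanish there; for `k = 0` the
  -- bound reads `1 ≤ 2`.
  · refine ⟨(1 - C a⁻¹ * X) ^ k, ?_, by simp, fun t h1 h2 => ?_⟩
    · refine natDegree_pow_le.trans ?_
      have : (1 - C a⁻¹ * X : ℝ[X]).natDegree ≤ 1 := by compute_degree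
      nlinarith
    · obtain rfl : a = t := le_antisymm h1 h2
      rw [div_self ha.ne']
      norm_num [ha.ne']
      rcases k with _ | k <;> simp
  · set κ := √(b / a) with hκ
    have hκ1 : 1 < κ := by
      rw [hκ, Real.lt_sqrt zero_le_one, one_pow, lt_div_iff₀ ha]; linarith
    have hκ2 : κ ^ 2 = b / a := Real.sq_sqrt (div_nonneg (by linarith) ha.le)
    have hb : b = κ ^ 2 * a := by rw [hκ2]; field_simp
    -- `ρ` is the Joukowski preimage of `(b + a) / (b - a)`, the image of `t = 0` under the affine
    -- map of `[a, b]` onto `[-1, 1]`, and `ρ⁻¹` is the claimed rate. Dropping `ρ⁻¹ ^ k` below is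
    -- what costs the factor 2.
    set ρ := (κ + 1) / (κ - 1) with hρ
    have hρ0 : 0 < ρ := div_pos (by linarith) (by linarith)
    have hx : (b + a) / (b - a) = (ρ + ρ⁻¹) / 2 := by
      have h1 : κ - 1 ≠ 0 := by linarith
      have h2 : κ + 1 ≠ 0 := by linarith
      have h3 : κ ^ 2 * a - a ≠ 0 := by rw [← hb]; linarith
      have h4 : κ ^ 2 - 1 ≠ 0 := by nlinarith
      rw [hρ, hb, inv_div]
      rw [show κ ^ 2 * a - a = a * (κ ^ 2 - 1) by ring, show κ ^ 2 * a + a = a * (κ ^ 2 + 1) by ring,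
        mul_div_mul_left _ _ ha.ne', show κ ^ 2 - 1 = (κ - 1) * (κ + 1) by ring]
      field_simp
      ring
    have hT : ρ ^ k / 2 ≤ (Chebyshev.T ℝ k).eval ((b + a) / (b - a)) := by
      rw [hx, eval_chebyshev_T_joukowski k hρ0.ne']
      have : 0 ≤ ρ⁻¹ ^ k := by positivity
      linarith
    have hρk : 0 < ρ ^ k := by positivity
    set D := (Chebyshev.T ℝ k).eval ((b + a) / (b - a)) with hD
    have hD0 : 0 < D := by linarith
    refine ⟨C D⁻¹ * (Chebyshev.T ℝ k).comp (C ((b + a) / (b - a)) - C (2 / (b - a)) * X),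
      ?_, ?_, fun t h1 h2 => ?_⟩
    · refine (natDegree_C_mul_le _ _).trans (natDegree_comp_le.trans ?_)
      have : (C ((b + a) / (b - a)) - C (2 / (b - a)) * X : ℝ[X]).natDegree ≤ 1 := by
        compute_degree
      have h2 : (Chebyshev.T ℝ k).natDegree ≤ k := by
        simp [Chebyshev.natDegree_T]
      nlinarith
    · simp [← hD, hD0.ne']
    · have hba : 0 < b - a := by linarith
      have hT1 : |(Chebyshev.T ℝ k).eval ((b + a) / (b - a) - 2 / (b - a) * t)| ≤ 1 := by
        apply Chebyshev.abs_eval_T_real_le_one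
        rw [show (b + a) / (b - a) - 2 / (b - a) * t = (b + a - 2 * t) / (b - a) by ring, abs_le,
          le_div_iff₀ hba, div_le_iff₀ hba]
        constructor <;> linarith
      have hr : 1 - 2 / (1 + κ) = ρ⁻¹ := by
        have : 1 + κ ≠ 0 := by linarith
        rw [hρ, inv_div, add_comm κ]; field_simp; ring
      rw [hr]
      simp only [eval_mul, eval_C, eval_comp, eval_sub, eval_X, abs_mul]
      rw [abs_of_pos (inv_pos.2 hD0)]
      calc D⁻¹ * _ ≤ D⁻¹ * 1 := by gcongr
        _ ≤ (ρ ^ k / 2)⁻¹ := by rw [mul_one]; exact inv_anti₀ (by positivity) hT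
        _ = 2 * ρ⁻¹ ^ k := by rw [inv_div, inv_pow]; rfl

/-! ### MINRES residuals and polynomials in a symmetric operator -/

section Minres

variable {E : Type*} [NormedAddCommGroup E] [InnerProductSpace ℝ E] [FiniteDimensional ℝ E]

theorem norm_aeval_le_of_eigenvalues {T : E →ₗ[ℝ] E} (hT : T.IsSymmetric) (p : ℝ[X]) {c : ℝ}
    (hc : ∀ (μ : ℝ) (x : E), x ≠ 0 → T x = μ • x → |p.eval μ| ≤ c) (x : E) :
    ‖aeval T p x‖ ≤ c * ‖x‖ := by
  set e := hT.eigenvectorBasis rfl with he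
  have hμ (i) : |p.eval (hT.eigenvalues rfl i)| ≤ c := by
    refine hc _ (e i) (e.orthonormal.ne_zero i) ?_
    exact hT.apply_eigenvectorBasis rfl i
  have hinner (i) : inner ℝ (e i) (aeval T p x) =
      p.eval (hT.eigenvalues rfl i) * inner ℝ (e i) x := by
    have hsymm : ∀ (q : ℝ[X]) (y z : E), inner ℝ y (aeval T q z) = inner ℝ (aeval T q y) z := by
      intro q
      induction q using Polynomial.induction_on' with
      | add q₁ q₂ h₁ h₂ => intro y z; simp [inner_add_left, inner_add_right, h₁, h₂]
      | monomial n a =>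
        intro y z
        have := (hT.pow n) y z
        simp [aeval_monomial, inner_smul_left, inner_smul_right, ← this]
    rw [hsymm]
    have hev : Module.End.HasEigenvector T (hT.eigenvalues rfl i) (e i) :=
      hT.hasEigenvector_eigenvectorBasis rfl i
    rw [Module.End.aeval_apply_of_hasEigenvector hev, inner_smul_left]
    simp
  -- In the zero space there is no eigenvalue to force `0 ≤ c`.
  rcases isEmpty_or_nonempty (Fin (Module.finrank ℝ E)) with hemp | ⟨⟨i₀⟩⟩
  · have : ‖aeval T p x‖ ^ 2 = 0 := by rw [← e.sum_sq_norm_inner_right]; simp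
    have h0 : ‖x‖ ^ 2 = 0 := by rw [← e.sum_sq_norm_inner_right]; simp
    rw [pow_eq_zero_iff (by norm_num)] at this h0
    simp [this, h0]
  have hc0 : 0 ≤ c := (abs_nonneg _).trans (hμ i₀)
  refine le_of_sq_le_sq ?_ (by positivity) 
  rw [mul_pow, ← e.sum_sq_norm_inner_right, ← e.sum_sq_norm_inner_right x, Finset.mul_sum]
  refine Finset.sum_le_sum fun i _ => ?_
  rw [hinner, norm_mul, mul_pow]
  gcongr
  exact hμ i

/-- Restricting to `S` discards eigenvalues with eigenvectors outside it. This is essential: the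
projectors create the eigenvalue `0`, where a residual polynomial equals 1. -/
theorem norm_aeval_le_of_eigenvalues_of_invariant {T : E →ₗ[ℝ] E} (hT : T.IsSymmetric)
    {S : Submodule ℝ E} (hS : ∀ x ∈ S, T x ∈ S) (p : ℝ[X]) {c : ℝ}
    (hc : ∀ (μ : ℝ), ∀ x ∈ S, x ≠ 0 → T x = μ • x → |p.eval μ| ≤ c) {x : E} (hx : x ∈ S) :
    ‖aeval T p x‖ ≤ c * ‖x‖ := by
  have hcoe : ∀ (q : ℝ[X]) (y : S), ((aeval (T.restrict hS) q y : S) : E) = aeval T q y := by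
    intro q
    induction q using Polynomial.induction_on' with
    | add q₁ q₂ h₁ h₂ => intro y; simp [h₁, h₂]
    | monomial n a =>
      intro y
      simp only [aeval_monomial, Module.End.mul_apply, Module.algebraMap_end_apply,
        Submodule.coe_smul]
      rw [Module.End.pow_restrict n]
      rfl
  have := norm_aeval_le_of_eigenvalues (hT.restrict_invariant hS) p (c := c)
    (fun μ y hy h => hc μ y y.2 (by simpa using hy) (by simpa using congrArg Subtype.val h)) ⟨x, hx⟩
  simpa only [Submodule.coe_norm, hcoe] using this

end Minres

theorem toEuclideanLin_pow {ι : Type*} [Fintype ι] [DecidableEq ι] (C : Matrix ι ι ℝ) (i : ℕ) :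
    Matrix.toEuclideanLin (C ^ i) = Matrix.toEuclideanLin C ^ i := by
  rw [Matrix.toEuclideanLin, Matrix.toLpLin_eq_toLin, Matrix.toLin_pow]

/-- Writing `p = 1 + X * q`, the vector `q(C) r` is a competitor in the Krylov space, which is the
same for `r` and `-r`. -/
theorem IsMinresIterate.norm_residual_le {ι : Type*} [Fintype ι] [DecidableEq ι]
    {C : Matrix ι ι ℝ} {r x : EuclideanSpace ℝ ι} {j : ℕ} (hx : IsMinresIterate C (-r) j x)
    {p : ℝ[X]} (hp : p.natDegree ≤ j) (hp0 : p.eval 0 = 1) :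
    ‖Matrix.toEuclideanLin C x + r‖ ≤ ‖aeval (Matrix.toEuclideanLin C) p r‖ := by
  set T := Matrix.toEuclideanLin C with hT
  set y : EuclideanSpace ℝ ι := ∑ i ∈ Finset.range j, p.coeff (i + 1) • (T ^ i) r with hy
  have hyK : y ∈ krylov C (-r) j := by
    refine Submodule.sum_mem _ fun i hi => Submodule.smul_mem _ _ ?_
    have : (Matrix.toEuclideanLin (C ^ i)) (-r) ∈ krylov C (-r) j :=
      Submodule.subset_span ⟨⟨i, Finset.mem_range.1 hi⟩, rfl⟩
    rw [map_neg, toEuclideanLin_pow] at this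
    simpa using Submodule.neg_mem _ this
  have hval : aeval T p r = T y + r := by
    rw [aeval_eq_sum_range' (Nat.lt_succ_of_le hp), Finset.sum_range_succ']
    rw [coeff_zero_eq_eval_zero, hp0]
    simp [hy, map_sum, pow_succ']
  have hneg (z : EuclideanSpace ℝ ι) : ‖-r - T z‖ = ‖T z + r‖ := by
    rw [← norm_neg]; congr 1; abel
  rw [hval, ← hneg, ← hneg]
  exact hx.2 y hyK

/-! ### Rotating one hyperplane onto another -/

section Rotation

variable {E : Type*} [NormedAddCommGroup E] [InnerProductSpace ℝ E]

/-- On the orthogonal complement of `a`, the rotation in the plane of the unit vectors `a` and `b`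
that takes `a` to `b`. -/
def rotate (a b y : E) : E := y - (inner ℝ b y / (1 + inner ℝ a b)) • (a + b)

/-- For `y ⊥ a` the formula is the reflection along `a + b`, since `‖a + b‖² = 2 (1 + ⟪a, b⟫)`;
hence it is isometric. -/
theorem inner_rotate_rotate {a b : E} (ha : ‖a‖ = 1) (hb : ‖b‖ = 1) (hab : 0 ≤ inner ℝ a b)
    {y z : E} (hy : inner ℝ a y = 0) (hz : inner ℝ a z = 0) :
    inner ℝ (rotate a b y) (rotate a b z) = inner ℝ y z := by
  have haa : inner ℝ a a = (1 : ℝ) := by rw [real_inner_self_eq_norm_sq, ha, one_pow]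
  have hbb : inner ℝ b b = (1 : ℝ) := by rw [real_inner_self_eq_norm_sq, hb, one_pow]
  have hc : 1 + inner ℝ a b ≠ 0 := by positivity
  simp only [rotate, inner_sub_left, inner_sub_right, inner_smul_left, inner_smul_right,
    inner_add_left, inner_add_right, haa, hbb, hz, real_inner_comm a b, real_inner_comm a y,
    real_inner_comm b y, hy]
  simp
  field_simp
  ring

theorem norm_rotate {a b : E} (ha : ‖a‖ = 1) (hb : ‖b‖ = 1) (hab : 0 ≤ inner ℝ a b)
    {y : E} (hy : inner ℝ a y = 0) : ‖rotate a b y‖ = ‖y‖ := by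
  have := inner_rotate_rotate ha hb hab hy hy
  rw [real_inner_self_eq_norm_sq, real_inner_self_eq_norm_sq] at this
  exact (sq_eq_sq₀ (norm_nonneg _) (norm_nonneg _)).1 this

theorem inner_rotate_eq_zero {a b : E} (hb : ‖b‖ = 1) (hab : 0 ≤ inner ℝ a b) (y : E) :
    inner ℝ b (rotate a b y) = 0 := by
  have hbb : inner ℝ b b = (1 : ℝ) := by rw [real_inner_self_eq_norm_sq, hb, one_pow]
  have hc : 1 + inner ℝ a b ≠ 0 := by positivity
  simp only [rotate, inner_sub_right, inner_smul_right, inner_add_right, hbb, real_inner_comm a b]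
  field_simp
  ring

theorem rotate_rotate {a b : E} (hb : ‖b‖ = 1) (hab : 0 ≤ inner ℝ a b)
    {x : E} (hx : inner ℝ b x = 0) : rotate a b (rotate b a x) = x := by
  have hbb : inner ℝ b b = (1 : ℝ) := by rw [real_inner_self_eq_norm_sq, hb, one_pow]
  have hc : 1 + inner ℝ a b ≠ 0 := by positivity
  have key : inner ℝ b (rotate b a x) / (1 + inner ℝ a b)
      = - (inner ℝ a x / (1 + inner ℝ b a)) := by
    simp only [rotate, inner_sub_right, inner_smul_right, inner_add_right, hx, hbb,
      real_inner_comm a b]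
    field_simp
    ring
  rw [rotate, key, rotate, add_comm b a]
  module

end Rotation

/-! ### Second-order perturbation of the compressed operator -/

section Perturbation

variable {E F : Type*} [NormedAddCommGroup E] [InnerProductSpace ℝ E]
  [NormedAddCommGroup F] [InnerProductSpace ℝ F]

/-- The sine of the angle between unit vectors, as the norm of a rejection. -/
theorem norm_sub_inner_smul_sq {a b : E} (ha : ‖a‖ = 1) (hb : ‖b‖ = 1) :
    ‖b - inner ℝ a b • a‖ ^ 2 = 1 - inner ℝ a b ^ 2 := by
  rw [norm_sub_sq_real, norm_smul, inner_smul_right, ha, hb, real_inner_comm, mul_one,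
    Real.norm_eq_abs, sq_abs]
  ring

/-- As `y ⊥ a`, `b` may be replaced by its rejection from `a`, whose squared norm `(1 - c) (1 + c)`,
with `c = ⟪a, b⟫`, cancels the denominator. -/
theorem norm_smul_rejection_le {a b : E} (ha : ‖a‖ = 1) (hb : ‖b‖ = 1) (hab : 0 ≤ inner ℝ a b)
    {y : E} (hy : inner ℝ a y = 0) :
    |inner ℝ b y| ≤ ‖b - inner ℝ a b • a‖ * ‖y‖ ∧
    ‖(inner ℝ b y / (1 + inner ℝ a b)) • (b - inner ℝ a b • a)‖ ≤ (1 - inner ℝ a b) * ‖y‖ := by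
  have h1 : |inner ℝ b y| ≤ ‖b - inner ℝ a b • a‖ * ‖y‖ := by
    have := abs_real_inner_le_norm (b - inner ℝ a b • a) y
    rwa [inner_sub_left, inner_smul_left, hy, mul_zero, sub_zero] at this
  refine ⟨h1, ?_⟩
  have hc : 0 < 1 + inner ℝ a b := by positivity
  have h2 := norm_sub_inner_smul_sq ha hb
  rw [norm_smul, Real.norm_eq_abs, abs_div, abs_of_pos hc, div_mul_eq_mul_div, div_le_iff₀ hc]
  calc |inner ℝ b y| * ‖b - inner ℝ a b • a‖
      ≤ ‖b - inner ℝ a b • a‖ * ‖y‖ * ‖b - inner ℝ a b • a‖ := by gcongr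
    _ = ‖b - inner ℝ a b • a‖ ^ 2 * ‖y‖ := by ring
    _ = _ := by rw [h2]; ring

theorem one_sub_le_sine {c σ : ℝ} (hc : 0 ≤ c) (hc1 : c ≤ 1) (hσ : 0 ≤ σ)
    (h : σ ^ 2 = 1 - c ^ 2) : 1 - c ≤ σ ^ 2 ∧ 1 - c ≤ σ := by
  constructor
  · nlinarith
  · refine le_of_sq_le_sq ?_ hσ
    nlinarith

/-- Compressing `T` to the complements of `b` and `b'` instead of those of a pair `a`, `a'` of
singular vectors perturbs the compression by at most `K * (sin φ + sin ψ) ^ 2`. -/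
theorem abs_inner_rotate_sub_le {T : F →ₗ[ℝ] E} {T' : E →ₗ[ℝ] F}
    (hTT' : ∀ y z, inner ℝ y (T z) = inner ℝ (T' y) z) {K s : ℝ} (hK : ∀ z, ‖T z‖ ≤ K * ‖z‖)
    {a b : E} {a' b' : F} (ha : ‖a‖ = 1) (hb : ‖b‖ = 1) (ha' : ‖a'‖ = 1) (hb' : ‖b'‖ = 1)
    (hab : 0 ≤ inner ℝ a b) (hab' : 0 ≤ inner ℝ a' b') (hTa : T a' = s • a) (hTa' : T' a = s • a')
    {y : E} {z : F} (hy : inner ℝ a y = 0) (hz : inner ℝ a' z = 0) :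
    |inner ℝ (rotate a b y) (T (rotate a' b' z)) - inner ℝ y (T z)| ≤
      K * (√(1 - inner ℝ a b ^ 2) + √(1 - inner ℝ a' b' ^ 2)) ^ 2 * ‖y‖ * ‖z‖ := by
  have haa : inner ℝ a a = (1 : ℝ) := by rw [real_inner_self_eq_norm_sq, ha, one_pow]
  have haa' : inner ℝ a' a' = (1 : ℝ) := by rw [real_inner_self_eq_norm_sq, ha', one_pow]
  have hKs : |s| ≤ K := by
    have := hK a'
    rwa [hTa, norm_smul, ha, ha', mul_one, mul_one] at this
  have hK0 : 0 ≤ K := (abs_nonneg s).trans hKs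
  obtain ⟨hby, hP⟩ := norm_smul_rejection_le ha hb hab hy
  obtain ⟨hbz, hQ⟩ := norm_smul_rejection_le ha' hb' hab' hz
  have hs1 := norm_sub_inner_smul_sq ha hb
  have hs2 := norm_sub_inner_smul_sq ha' hb'
  rw [← hs1, ← hs2, Real.sqrt_sq (norm_nonneg _), Real.sqrt_sq (norm_nonneg _)]
  -- The rotated vector is `y - P - ⟪b, y⟫ a` with `P ⊥ a`: `P` is already of second order in the
  -- sine, and the only first-order part is along `a`.
  have hRy : rotate a b y = y - (inner ℝ b y / (1 + inner ℝ a b)) • (b - inner ℝ a b • a)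
      - inner ℝ b y • a := by
    have hc : 1 + inner ℝ a b ≠ 0 := by positivity
    have : inner ℝ b y = inner ℝ b y / (1 + inner ℝ a b) * (1 + inner ℝ a b) := by field_simp
    rw [rotate]
    nth_rewrite 3 [this]
    module
  have hRz : rotate a' b' z = z - (inner ℝ b' z / (1 + inner ℝ a' b')) • (b' - inner ℝ a' b' • a')
      - inner ℝ b' z • a' := by
    have hc : 1 + inner ℝ a' b' ≠ 0 := by positivity
    have : inner ℝ b' z = inner ℝ b' z / (1 + inner ℝ a' b') * (1 + inner ℝ a' b') := by field_simp
    rw [rotate]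
    nth_rewrite 3 [this]
    module
  have hPa : inner ℝ ((inner ℝ b y / (1 + inner ℝ a b)) • (b - inner ℝ a b • a)) a = 0 := by
    simp only [inner_smul_left, inner_sub_left, haa, real_inner_comm a b]
    simp
  have hQa : inner ℝ a' ((inner ℝ b' z / (1 + inner ℝ a' b')) • (b' - inner ℝ a' b' • a')) = 0 := by
    simp only [inner_smul_right, inner_sub_right, haa']
    simp
  have hc1 : inner ℝ a b ≤ 1 := by simpa [ha, hb] using real_inner_le_norm a b
  have hc2 : inner ℝ a' b' ≤ 1 := by simpa [ha', hb'] using real_inner_le_norm a' b'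
  rw [hRy, hRz]
  generalize (inner ℝ b y / (1 + inner ℝ a b)) • (b - inner ℝ a b • a) = P at *
  generalize (inner ℝ b' z / (1 + inner ℝ a' b')) • (b' - inner ℝ a' b' • a') = Q at *
  -- The first-order parts along `a` and `a'` meet only each other, because `T` and `T'` exchange
  -- these lines and hence also their complements; their product is of second order.
  have hid : inner ℝ (y - P - inner ℝ b y • a) (T (z - Q - inner ℝ b' z • a')) - inner ℝ y (T z) =
      - inner ℝ P (T z) - inner ℝ y (T Q) + inner ℝ P (T Q) + s * inner ℝ b y * inner ℝ b' z := by
    have h1 : inner ℝ a (T z) = 0 := by rw [hTT', hTa', inner_smul_left, hz, mul_zero]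
    have h2 : inner ℝ a (T Q) = 0 := by rw [hTT', hTa', inner_smul_left, hQa, mul_zero]
    have h3 : inner ℝ y a = 0 := by rw [real_inner_comm, hy]
    simp only [map_sub, map_smul, inner_sub_left, inner_sub_right, inner_smul_left,
      inner_smul_right, hTa, h1, h2, h3, hPa, haa]
    simp
    ring
  rw [hid]
  have hin : ∀ (x : E) (x' : F) (m n : ℝ), 0 ≤ m → ‖x‖ ≤ m → ‖x'‖ ≤ n →
      |inner ℝ x (T x')| ≤ K * (m * n) := by
    intro x x' m n hm hx hx'
    calc |inner ℝ x (T x')| ≤ ‖x‖ * ‖T x'‖ := abs_real_inner_le_norm _ _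
      _ ≤ m * (K * n) := by
        gcongr
        exact (hK x').trans (by gcongr)
      _ = _ := by ring
  have e1 := hin P z _ _ (mul_nonneg (by linarith) (norm_nonneg y)) hP le_rfl
  have e2 := hin y Q _ _ (norm_nonneg _) le_rfl hQ
  have e3 := hin P Q _ _ (mul_nonneg (by linarith) (norm_nonneg y)) hP hQ
  have e4 : |s * inner ℝ b y * inner ℝ b' z| ≤
      K * (‖b - inner ℝ a b • a‖ * ‖y‖) * (‖b' - inner ℝ a' b' • a'‖ * ‖z‖) := by
    rw [abs_mul, abs_mul]; gcongr
  generalize inner ℝ a b = c at *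
  generalize inner ℝ a' b' = c' at *
  generalize ‖b - c • a‖ = σ, norm_nonneg (b - c • a) = hσ at *
  generalize ‖b' - c' • a'‖ = σ', norm_nonneg (b' - c' • a') = hσ' at *
  obtain ⟨m1, n1⟩ := one_sub_le_sine hab hc1 hσ hs1
  obtain ⟨m2, n2⟩ := one_sub_le_sine hab' hc2 hσ' hs2
  have m3 : (1 - c) * (1 - c') ≤ σ * σ' := mul_le_mul n1 n2 (by linarith) hσ
  -- `1 - c ≤ σ²`, `1 - c' ≤ σ'²` and two products each at most `σ σ'` add up to exactly `(σ +
  -- σ')²`.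
  have hfin : K * ‖y‖ * ‖z‖ * ((1 - c) + (1 - c') + (1 - c) * (1 - c') + σ * σ') ≤
      K * ‖y‖ * ‖z‖ * (σ + σ') ^ 2 := by
    gcongr
    rw [add_sq]
    linarith
  rw [abs_le] at e1 e2 e3 e4 ⊢
  constructor <;> linarith

/-- The residual `e = T z - μ y` is itself orthogonal to `a`, so it may be used as test vector. The
Galerkin condition on its rotation turns the form bound into `‖e‖² ≤ δ ‖e‖ ‖z‖`. -/
theorem norm_sub_smul_le_of_rotate {T : F →ₗ[ℝ] E} {T' : E →ₗ[ℝ] F}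
    (hTT' : ∀ y z, inner ℝ y (T z) = inner ℝ (T' y) z) {s δ μ : ℝ} (hδ0 : 0 ≤ δ)
    {a b : E} {a' b' : F} (ha : ‖a‖ = 1) (hb : ‖b‖ = 1)
    (hab : 0 ≤ inner ℝ a b) (hTa' : T' a = s • a')
    (hδ : ∀ y z, inner ℝ a y = 0 → inner ℝ a' z = 0 →
      |inner ℝ (rotate a b y) (T (rotate a' b' z)) - inner ℝ y (T z)| ≤ δ * ‖y‖ * ‖z‖)
    {y : E} {z : F} (hy : inner ℝ a y = 0) (hz : inner ℝ a' z = 0)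
    (h : ∀ x, inner ℝ b x = 0 →
      inner ℝ x (T (rotate a' b' z)) = μ * inner ℝ x (rotate a b y)) :
    ‖T z - μ • y‖ ≤ δ * ‖z‖ := by
  set e := T z - μ • y with he
  have hea : inner ℝ a e = 0 := by
    rw [he, inner_sub_right, inner_smul_right, hy, hTT', hTa', inner_smul_left, hz]; simp
  have key := hδ e z hea hz
  rw [h _ (inner_rotate_eq_zero hb hab e), inner_rotate_rotate ha hb hab hea hy,
    abs_sub_comm] at key
  have hee : ‖e‖ ^ 2 = inner ℝ e (T z) - μ * inner ℝ e y := by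
    rw [← real_inner_self_eq_norm_sq]
    nth_rewrite 2 [he]
    rw [inner_sub_right, inner_smul_right]
  have hle := (le_abs_self _).trans key
  rw [← hee] at hle
  rcases (norm_nonneg e).eq_or_lt with h0 | h0
  · rw [← h0]; positivity
  · exact le_of_mul_le_mul_right (by linarith) h0

/-- A singular triplet of the compression of `T` to the complements of `b` and `b'` is an
approximate singular triplet of `T`, orthogonal to `a` and `a'`. -/
theorem exists_approx_singular_triplet {T : F →ₗ[ℝ] E} {T' : E →ₗ[ℝ] F}
    (hTT' : ∀ y z, inner ℝ y (T z) = inner ℝ (T' y) z) {s δ μ : ℝ} (hδ0 : 0 ≤ δ)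
    {a b : E} {a' b' : F} (ha : ‖a‖ = 1) (hb : ‖b‖ = 1) (ha' : ‖a'‖ = 1) (hb' : ‖b'‖ = 1)
    (hab : 0 ≤ inner ℝ a b) (hab' : 0 ≤ inner ℝ a' b') (hTa : T a' = s • a) (hTa' : T' a = s • a')
    (hδ : ∀ y z, inner ℝ a y = 0 → inner ℝ a' z = 0 →
      |inner ℝ (rotate a b y) (T (rotate a' b' z)) - inner ℝ y (T z)| ≤ δ * ‖y‖ * ‖z‖)
    {x : E} {x' : F} (hx : inner ℝ b x = 0) (hx' : inner ℝ b' x' = 0)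
    (h1 : ∀ y, inner ℝ b y = 0 → inner ℝ y (T x') = μ * inner ℝ y x)
    (h2 : ∀ z, inner ℝ b' z = 0 → inner ℝ z (T' x) = μ * inner ℝ z x') :
    ∃ y z, inner ℝ a y = 0 ∧ inner ℝ a' z = 0 ∧ ‖y‖ = ‖x‖ ∧ ‖z‖ = ‖x'‖ ∧
      ‖T z - μ • y‖ ≤ δ * ‖z‖ ∧ ‖T' y - μ • z‖ ≤ δ * ‖y‖ := by
  have hba : 0 ≤ inner ℝ b a := by rwa [real_inner_comm]
  have hba' : 0 ≤ inner ℝ b' a' := by rwa [real_inner_comm]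
  have hRy := rotate_rotate hb hab hx
  have hRz := rotate_rotate hb' hab' hx'
  refine ⟨rotate b a x, rotate b' a' x', inner_rotate_eq_zero ha hba x,
    inner_rotate_eq_zero ha' hba' x', norm_rotate hb ha hba hx, norm_rotate hb' ha' hba' hx',
    norm_sub_smul_le_of_rotate hTT' hδ0 ha hb hab hTa' hδ (inner_rotate_eq_zero ha hba x)
      (inner_rotate_eq_zero ha' hba' x') (by rwa [hRy, hRz]),
    norm_sub_smul_le_of_rotate (fun z y => ?_) hδ0 ha' hb' hab' hTa (fun z y hz hy => ?_)
      (inner_rotate_eq_zero ha' hba' x') (inner_rotate_eq_zero ha hba x) (by rwa [hRy, hRz])⟩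
  · rw [real_inner_comm, ← hTT', real_inner_comm]
  · rw [real_inner_comm, ← hTT', real_inner_comm (T' y) z, ← hTT', mul_right_comm]
    exact hδ y z hy hz

end Perturbation


/-! ### Spectral bounds from singular bases -/

section SingularBasis

variable {E F : Type*} [NormedAddCommGroup E] [InnerProductSpace ℝ E]
  [NormedAddCommGroup F] [InnerProductSpace ℝ F] {M N : ℕ}

/-- `e` and `f` are orthonormal bases of left and right singular vectors of `T`, whose adjoint is
`T'`, for the singular values `σ`. -/
structure IsSingularBasis (hMN : N ≤ M) (T : F →ₗ[ℝ] E) (T' : E →ₗ[ℝ] F)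
    (e : OrthonormalBasis (Fin M) ℝ E) (f : OrthonormalBasis (Fin N) ℝ F) (σ : Fin N → ℝ) :
    Prop where
  adjoint : ∀ y z, inner ℝ y (T z) = inner ℝ (T' y) z
  map_right : ∀ j, T (f j) = σ j • e (Fin.castLE hMN j)
  map_left : ∀ j, T' (e (Fin.castLE hMN j)) = σ j • f j
  map_left_of_le : ∀ i : Fin M, N ≤ i → T' (e i) = 0

theorem sum_eq_sum_castLE_add {hMN : N ≤ M} (g : Fin M → ℝ) :
    ∑ i, g i = ∑ j : Fin N, g (Fin.castLE hMN j) + ∑ i : Fin M with N ≤ i.1, g i := by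
  rw [← Finset.sum_filter_add_sum_filter_not Finset.univ (fun i : Fin M => i.1 < N)]
  simp only [not_lt]
  congr 1
  symm
  refine Finset.sum_bij (fun j _ => Fin.castLE hMN j) (by simp) ?_ ?_ (by simp)
  · intro i _ j _ h
    exact Fin.castLE_injective hMN h
  · intro i hi
    exact ⟨⟨i, by simpa using hi⟩, by simp, rfl⟩

namespace IsSingularBasis

variable {hMN : N ≤ M} {T : F →ₗ[ℝ] E} {T' : E →ₗ[ℝ] F}
  {e : OrthonormalBasis (Fin M) ℝ E} {f : OrthonormalBasis (Fin N) ℝ F} {σ : Fin N → ℝ}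

theorem inner_left_map (h : IsSingularBasis hMN T T' e f σ) (j : Fin N) (z : F) :
    inner ℝ (e (Fin.castLE hMN j)) (T z) = σ j * inner ℝ (f j) z := by
  rw [h.adjoint, h.map_left, inner_smul_left]; simp

theorem inner_left_map_of_le (h : IsSingularBasis hMN T T' e f σ) {i : Fin M} (hi : N ≤ i.1)
    (z : F) : inner ℝ (e i) (T z) = 0 := by
  rw [h.adjoint, h.map_left_of_le i hi, inner_zero_left]

theorem inner_right_map (h : IsSingularBasis hMN T T' e f σ) (j : Fin N) (y : E) :
    inner ℝ (f j) (T' y) = σ j * inner ℝ (e (Fin.castLE hMN j)) y := by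
  rw [real_inner_comm, ← h.adjoint, h.map_right, inner_smul_right, real_inner_comm]

theorem norm_map_sq (h : IsSingularBasis hMN T T' e f σ) (z : F) :
    ‖T z‖ ^ 2 = ∑ j, σ j ^ 2 * inner ℝ (f j) z ^ 2 := by
  rw [← e.sum_sq_inner_right, sum_eq_sum_castLE_add (hMN := hMN)]
  simp only [h.inner_left_map]
  rw [Finset.sum_eq_zero (s := Finset.univ.filter _), add_zero]
  · simp only [mul_pow]
  · intro i hi
    rw [h.inner_left_map_of_le (by simpa using hi)]; simp

theorem norm_map_le (h : IsSingularBasis hMN T T' e f σ) {j₀ : Fin N} {K : ℝ}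
    (hK : ∀ j, j ≠ j₀ → |σ j| ≤ K) (hK0 : 0 ≤ K) {z : F} (hz : inner ℝ (f j₀) z = 0) :
    ‖T z‖ ≤ K * ‖z‖ := by
  refine le_of_sq_le_sq ?_ (by positivity)
  rw [h.norm_map_sq, mul_pow, ← f.sum_sq_inner_right, Finset.mul_sum]
  refine Finset.sum_le_sum fun j _ => ?_
  by_cases hj : j = j₀
  · subst hj; rw [hz]; simp
  · gcongr 1
    exact sq_le_sq' (by linarith [abs_le.1 (hK j hj)]) ((le_abs_self _).trans (hK j hj))

theorem le_norm_map (h : IsSingularBasis hMN T T' e f σ) {j₀ : Fin N} {k : ℝ}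
    (hk : ∀ j, j ≠ j₀ → k ≤ σ j) (hk0 : 0 ≤ k) {z : F} (hz : inner ℝ (f j₀) z = 0) :
    k * ‖z‖ ≤ ‖T z‖ := by
  refine le_of_sq_le_sq ?_ (by positivity)
  rw [h.norm_map_sq, mul_pow, ← f.sum_sq_inner_right, Finset.mul_sum]
  refine Finset.sum_le_sum fun j _ => ?_
  by_cases hj : j = j₀
  · subst hj; rw [hz]; simp
  · gcongr 1
    exact pow_le_pow_left₀ hk0 (hk j hj) 2

/-- For a square operator, the roles of the left and right singular vectors can be exchanged. -/
theorem symm {hNN : N ≤ N} {e : OrthonormalBasis (Fin N) ℝ E}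
    (h : IsSingularBasis hNN T T' e f σ) : IsSingularBasis hNN T' T f e σ where
  adjoint y z := by rw [real_inner_comm, ← h.adjoint, real_inner_comm]
  map_right := h.map_left
  map_left := h.map_right
  map_left_of_le i hi := absurd i.2 (by omega)

/-- The Jordan–Wielandt operator of `T`, shifted by `τ`, is bounded below on the complement of a
pair of singular vectors by the distance of `τ` to the rest of the spectrum. -/
theorem le_norm_sub_sq_add (h : IsSingularBasis hMN T T' e f σ) {j₀ : Fin N} {g τ : ℝ}
    (hσ : ∀ j, 0 ≤ σ j) (hτ : 0 ≤ τ) (hg0 : 0 ≤ g) (hgτ : g ≤ τ)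
    (hg : ∀ j, j ≠ j₀ → g ≤ |σ j - τ|) {y : E} {z : F}
    (hy : inner ℝ (e (Fin.castLE hMN j₀)) y = 0) (hz : inner ℝ (f j₀) z = 0) :
    g ^ 2 * (‖y‖ ^ 2 + ‖z‖ ^ 2) ≤ ‖T z - τ • y‖ ^ 2 + ‖T' y - τ • z‖ ^ 2 := by
  rw [← e.sum_sq_inner_right, ← e.sum_sq_inner_right (T z - τ • y), ← f.sum_sq_inner_right,
    ← f.sum_sq_inner_right (T' y - τ • z), sum_eq_sum_castLE_add (hMN := hMN),
    sum_eq_sum_castLE_add (hMN := hMN) (fun i => inner ℝ (e i) (T z - τ • y) ^ 2)]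
  simp only [inner_sub_right, inner_smul_right, h.inner_left_map, h.inner_right_map]
  -- Left singular vectors without a partner are killed by `T'`; they contribute the eigenvalue `0`,
  -- at distance `τ`, hence the need for `g ≤ τ`.
  have h1 : g ^ 2 * ∑ i : Fin M with N ≤ i.1, inner ℝ (e i) y ^ 2 ≤
      ∑ i : Fin M with N ≤ i.1, (inner ℝ (e i) (T z) - τ * inner ℝ (e i) y) ^ 2 := by
    rw [Finset.mul_sum]
    refine Finset.sum_le_sum fun i hi => ?_
    rw [h.inner_left_map_of_le (by simpa using hi), zero_sub, neg_sq, mul_pow]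
    gcongr
  have h2 : g ^ 2 * (∑ j, inner ℝ (e (Fin.castLE hMN j)) y ^ 2 + ∑ j, inner ℝ (f j) z ^ 2) ≤
      ∑ j, (σ j * inner ℝ (f j) z - τ * inner ℝ (e (Fin.castLE hMN j)) y) ^ 2 +
      ∑ j, (σ j * inner ℝ (e (Fin.castLE hMN j)) y - τ * inner ℝ (f j) z) ^ 2 := by
    rw [← Finset.sum_add_distrib, ← Finset.sum_add_distrib, Finset.mul_sum]
    refine Finset.sum_le_sum fun j _ => ?_
    by_cases hj : j = j₀
    · subst hj; rw [hy, hz]; simp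
    · have hgj : g ^ 2 ≤ (σ j - τ) ^ 2 := by
        rw [← sq_abs (σ j - τ)]; exact pow_le_pow_left₀ hg0 (hg j hj) 2
      generalize inner ℝ (e (Fin.castLE hMN j)) y = p
      generalize inner ℝ (f j) z = q
      have h3 : g ^ 2 * (p ^ 2 + q ^ 2) ≤ (σ j - τ) ^ 2 * (p ^ 2 + q ^ 2) := by gcongr
      have h4 : 0 ≤ σ j * τ * (p - q) ^ 2 := by have := hσ j; positivity
      -- The identity is `(σq - τp)² + (σp - τq)² = (σ - τ)² (p² + q²) + 2στ (p - q)²`.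
      nlinarith
  linarith

end IsSingularBasis

variable {hMN : N ≤ M} {T : F →ₗ[ℝ] E} {T' : E →ₗ[ℝ] F}
  {e : OrthonormalBasis (Fin M) ℝ E} {f : OrthonormalBasis (Fin N) ℝ F} {σ : Fin N → ℝ}

theorem abs_le_of_approx {K δ μ : ℝ} {y : E} {z : F} (hz0 : 0 < ‖z‖) (hyz : ‖y‖ = ‖z‖)
    (hT : ‖T z‖ ≤ K * ‖z‖) (hz : ‖T z - μ • y‖ ≤ δ * ‖z‖) : |μ| ≤ K + δ := by
  have : ‖μ • y‖ ≤ ‖T z‖ + ‖T z - μ • y‖ := by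
    have := norm_sub_le (T z) (T z - μ • y)
    rwa [sub_sub_cancel] at this
  rw [norm_smul, hyz, Real.norm_eq_abs] at this
  exact le_of_mul_le_mul_right (by linarith) hz0

theorem le_abs_of_approx {k δ μ : ℝ} {y : E} {z : F} (hz0 : 0 < ‖z‖) (hyz : ‖y‖ = ‖z‖)
    (hT : k * ‖z‖ ≤ ‖T z‖) (hz : ‖T z - μ • y‖ ≤ δ * ‖z‖) : k - δ ≤ |μ| := by
  have := norm_sub_norm_le (T z) (μ • y)
  rw [norm_smul, hyz, Real.norm_eq_abs] at this
  exact le_of_mul_le_mul_right (by linarith) hz0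

/-- At `μ = 0` the norms of `y` and `z` need not agree, so the halves of the triplet have to be
excluded separately. -/
theorem eq_zero_of_approx {k δ : ℝ} {y : E} {z : F} (hkδ : δ < k)
    (hT : k * ‖z‖ ≤ ‖T z‖) (hz : ‖T z - (0 : ℝ) • y‖ ≤ δ * ‖z‖) : z = 0 := by
  rw [zero_smul, sub_zero] at hz
  by_contra h
  have : 0 < ‖z‖ := norm_pos_iff.2 h
  nlinarith

/-- Perturbation bound for the eigenvalues of the shifted Jordan–Wielandt operator. -/
theorem le_abs_sub_of_approx (h : IsSingularBasis hMN T T' e f σ) {j₀ : Fin N} {g τ δ μ : ℝ}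
    (hσ : ∀ j, 0 ≤ σ j) (hτ : 0 ≤ τ) (hδ0 : 0 ≤ δ) (hδg : δ ≤ g) (hgτ : g ≤ τ)
    (hg : ∀ j, j ≠ j₀ → g ≤ |σ j - τ|) {y : E} {z : F}
    (hy : inner ℝ (e (Fin.castLE hMN j₀)) y = 0) (hz : inner ℝ (f j₀) z = 0)
    (hyz : 0 < ‖y‖ ^ 2 + ‖z‖ ^ 2) (h1 : ‖T z - μ • y‖ ≤ δ * ‖z‖) (h2 : ‖T' y - μ • z‖ ≤ δ * ‖y‖) :
    g - δ ≤ |μ - τ| := by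
  have key := h.le_norm_sub_sq_add hσ hτ (hδ0.trans hδg) hgτ hg hy hz
  have b1 : ‖T z - τ • y‖ ≤ δ * ‖z‖ + |μ - τ| * ‖y‖ := by
    have := norm_add_le (T z - μ • y) ((μ - τ) • y)
    rw [norm_smul, Real.norm_eq_abs, show T z - μ • y + (μ - τ) • y = T z - τ • y by module] at this
    linarith
  have b2 : ‖T' y - τ • z‖ ≤ δ * ‖y‖ + |μ - τ| * ‖z‖ := by
    have := norm_add_le (T' y - μ • z) ((μ - τ) • z)
    rw [norm_smul, Real.norm_eq_abs, show T' y - μ • z + (μ - τ) • z = T' y - τ • z by module]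
      at this
    linarith
  have b1' := pow_le_pow_left₀ (norm_nonneg _) b1 2
  have b2' := pow_le_pow_left₀ (norm_nonneg _) b2 2
  have hl := abs_nonneg (μ - τ)
  generalize |μ - τ| = l at *
  generalize ‖y‖ = p at *
  generalize ‖z‖ = q at *
  -- `(δq + lp)² + (δp + lq)²` falls short of `(δ + l)² (p² + q²)` by `2δl (p - q)²`; so `‖y‖ = ‖z‖`
  -- is not needed and `μ = 0` is covered.
  have h4 : 0 ≤ δ * l * (p - q) ^ 2 := by positivity
  have h5 : g ^ 2 * (p ^ 2 + q ^ 2) ≤ (δ + l) ^ 2 * (p ^ 2 + q ^ 2) := by linarith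
  have h6 := le_of_mul_le_mul_right h5 hyz
  have h7 : g ≤ δ + l := le_of_sq_le_sq h6 (by positivity)
  linarith

end SingularBasis

/-! ### Singular bases from the columns of `U` and `V` -/

section Columns

theorem orthonormal_column {n : ℕ} {U : Matrix (Fin n) (Fin n) ℝ}
    (hU : U ∈ Matrix.orthogonalGroup (Fin n) ℝ) : Orthonormal ℝ (column U) := by
  rw [orthonormal_iff_ite]
  intro i j
  have := congrFun (congrFun ((Matrix.mem_orthogonalGroup_iff' (Fin n) ℝ).1 hU) i) j
  rw [Matrix.one_apply, Matrix.mul_apply] at this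
  rw [← this, PiLp.inner_apply]
  refine Finset.sum_congr rfl fun k _ => ?_
  simp [column, mul_comm]

/-- The columns of an orthogonal matrix. -/
def columnBasis {n : ℕ} {U : Matrix (Fin n) (Fin n) ℝ}
    (hU : U ∈ Matrix.orthogonalGroup (Fin n) ℝ) :
    OrthonormalBasis (Fin n) ℝ (EuclideanSpace ℝ (Fin n)) :=
  OrthonormalBasis.mk (orthonormal_column hU)
    ((orthonormal_column hU).linearIndependent.span_eq_top_of_card_eq_finrank' (by simp)).ge

theorem columnBasis_apply {n : ℕ} {U : Matrix (Fin n) (Fin n) ℝ}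
    (hU : U ∈ Matrix.orthogonalGroup (Fin n) ℝ) (i : Fin n) : columnBasis hU i = column U i := by
  simp [columnBasis]

theorem inner_toEuclideanLin_eq {M N : ℕ} (A : Matrix (Fin M) (Fin N) ℝ)
    (y : EuclideanSpace ℝ (Fin M)) (z : EuclideanSpace ℝ (Fin N)) :
    inner ℝ y (Matrix.toEuclideanLin A z) = inner ℝ (Matrix.toEuclideanLin A.transpose y) z := by
  rw [← Matrix.conjTranspose_eq_transpose_of_trivial,
    Matrix.toEuclideanLin_conjTranspose_eq_adjoint, LinearMap.adjoint_inner_left]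

theorem toEuclideanLin_column {M N : ℕ} (A : Matrix (Fin M) (Fin N) ℝ)
    (V : Matrix (Fin N) (Fin N) ℝ) (j : Fin N) :
    Matrix.toEuclideanLin A (column V j) = WithLp.toLp 2 fun k => (A * V) k j := by
  ext k
  simp [column, Matrix.mul_apply, Matrix.mulVec, dotProduct]

theorem IsSVD.isSingularBasis {M N : ℕ} (hMN : N ≤ M) {A : Matrix (Fin M) (Fin N) ℝ}
    {U : Matrix (Fin M) (Fin M) ℝ} {σ : Fin N → ℝ} {V : Matrix (Fin N) (Fin N) ℝ}
    (h : IsSVD A U σ V) :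
    IsSingularBasis hMN (Matrix.toEuclideanLin A) (Matrix.toEuclideanLin A.transpose)
      (columnBasis h.left_orthogonal) (columnBasis h.right_orthogonal) σ := by
  have hU := (Matrix.mem_orthogonalGroup_iff' (Fin M) ℝ).1 h.left_orthogonal
  have hV := (Matrix.mem_orthogonalGroup_iff' (Fin N) ℝ).1 h.right_orthogonal
  change U.transpose * U = 1 at hU
  change V.transpose * V = 1 at hV
  have hAV : A * V = U * rectDiagonal M σ := by
    rw [h.eq, Matrix.mul_assoc, hV, Matrix.mul_one]
  have hAU : A.transpose * U = V * (rectDiagonal M σ).transpose := by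
    rw [h.eq, Matrix.transpose_mul, Matrix.transpose_mul, Matrix.transpose_transpose,
      Matrix.mul_assoc, Matrix.mul_assoc, hU, Matrix.mul_one]
  refine ⟨inner_toEuclideanLin_eq A, fun j => ?_, fun j => ?_, fun i hi => ?_⟩
  · rw [columnBasis_apply, columnBasis_apply, toEuclideanLin_column, hAV]
    ext k
    simp only [Matrix.mul_apply, rectDiagonal, Matrix.of_apply, PiLp.smul_apply, column]
    rw [Finset.sum_eq_single (Fin.castLE hMN j)]
    · simp [mul_comm]
    · intro i _ hi
      rw [if_neg, mul_zero]
      exact fun hij => hi (Fin.ext hij)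
    · simp
  · rw [columnBasis_apply, columnBasis_apply, toEuclideanLin_column, hAU]
    ext k
    simp only [Matrix.mul_apply, rectDiagonal, Matrix.of_apply, PiLp.smul_apply, column,
      Matrix.transpose_apply]
    rw [Finset.sum_eq_single j]
    · simp [mul_comm]
    · intro i _ hi
      rw [if_neg, mul_zero]
      exact fun hij => hi (Fin.ext hij.symm)
    · simp
  · rw [columnBasis_apply, toEuclideanLin_column, hAU]
    ext k
    simp only [Matrix.mul_apply, rectDiagonal, Matrix.of_apply, Matrix.transpose_apply]
    refine Finset.sum_eq_zero fun j _ => ?_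
    rw [if_neg (by omega), mul_zero]

end Columns

/-! ### Block structure of the correction matrix -/

section Blocks

variable {M N : ℕ}

/-- The component of a vector in `ℝ^M`. -/
def upper (x : EuclideanSpace ℝ (Fin M ⊕ Fin N)) : EuclideanSpace ℝ (Fin M) :=
  WithLp.toLp 2 fun i => x (Sum.inl i)

/-- The component of a vector in `ℝ^N`. -/
def lower (x : EuclideanSpace ℝ (Fin M ⊕ Fin N)) : EuclideanSpace ℝ (Fin N) :=
  WithLp.toLp 2 fun j => x (Sum.inr j)

/-- The vector with the given components in `ℝ^M` and `ℝ^N`. -/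
def stack (y : EuclideanSpace ℝ (Fin M)) (z : EuclideanSpace ℝ (Fin N)) :
    EuclideanSpace ℝ (Fin M ⊕ Fin N) :=
  WithLp.toLp 2 (Sum.elim y z)

@[simp] theorem upper_stack (y : EuclideanSpace ℝ (Fin M)) (z : EuclideanSpace ℝ (Fin N)) :
    upper (stack y z) = y := rfl

@[simp] theorem lower_stack (y : EuclideanSpace ℝ (Fin M)) (z : EuclideanSpace ℝ (Fin N)) :
    lower (stack y z) = z := rfl

theorem stack_upper_lower (x : EuclideanSpace ℝ (Fin M ⊕ Fin N)) :
    stack (upper x) (lower x) = x := by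
  ext i; rcases i with i | i <;> rfl

theorem inner_eq_upper_add_lower (x y : EuclideanSpace ℝ (Fin M ⊕ Fin N)) :
    inner ℝ x y = inner ℝ (upper x) (upper y) + inner ℝ (lower x) (lower y) := by
  simp [PiLp.inner_apply, upper, lower]

theorem biPerp_iff {r : EuclideanSpace ℝ (Fin M ⊕ Fin N)} {u : EuclideanSpace ℝ (Fin M)}
    {v : EuclideanSpace ℝ (Fin N)} :
    BiPerp r u v ↔ inner ℝ u (upper r) = 0 ∧ inner ℝ v (lower r) = 0 := by
  simp [BiPerp, PiLp.inner_apply, upper, lower]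

/-- The doubly orthogonal vectors form a subspace. -/
def biPerpSubmodule (u : EuclideanSpace ℝ (Fin M)) (v : EuclideanSpace ℝ (Fin N)) :
    Submodule ℝ (EuclideanSpace ℝ (Fin M ⊕ Fin N)) where
  carrier := {x | BiPerp x u v}
  zero_mem' := by simp [BiPerp]
  add_mem' {x y} hx hy := by
    simp only [Set.mem_ofPred_eq, BiPerp, PiLp.add_apply, add_mul, Finset.sum_add_distrib] at *
    simp [hx.1, hx.2, hy.1, hy.2]
  smul_mem' c x hx := by
    simp only [Set.mem_ofPred_eq, BiPerp, PiLp.smul_apply, smul_eq_mul, mul_assoc,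
      ← Finset.mul_sum] at *
    simp [hx.1, hx.2]

theorem mem_biPerpSubmodule {r : EuclideanSpace ℝ (Fin M ⊕ Fin N)} {u : EuclideanSpace ℝ (Fin M)}
    {v : EuclideanSpace ℝ (Fin N)} :
    r ∈ biPerpSubmodule u v ↔ inner ℝ u (upper r) = 0 ∧ inner ℝ v (lower r) = 0 :=
  biPerp_iff

theorem toEuclideanLin_projector (u : EuclideanSpace ℝ (Fin M)) (v : EuclideanSpace ℝ (Fin N))
    (x : EuclideanSpace ℝ (Fin M ⊕ Fin N)) :
    Matrix.toEuclideanLin (projector u v) x =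
      stack (upper x - inner ℝ u (upper x) • u) (lower x - inner ℝ v (lower x) • v) := by
  ext i
  rw [Matrix.ofLp_toLpLin, Matrix.toLin'_apply, projector, Matrix.fromBlocks_mulVec]
  rcases i with i | i
  · simp [stack, upper, Matrix.sub_mulVec, Matrix.vecMulVec_mulVec, PiLp.inner_apply, dotProduct,
      mul_comm]
  · simp [stack, lower, Matrix.sub_mulVec, Matrix.vecMulVec_mulVec, PiLp.inner_apply, dotProduct,
      mul_comm]

theorem toEuclideanLin_augmented (A : Matrix (Fin M) (Fin N) ℝ) (τ : ℝ)
    (x : EuclideanSpace ℝ (Fin M ⊕ Fin N)) :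
    Matrix.toEuclideanLin (augmented A τ) x =
      stack (Matrix.toEuclideanLin A (lower x) - τ • upper x)
        (Matrix.toEuclideanLin A.transpose (upper x) - τ • lower x) := by
  ext i
  rw [Matrix.ofLp_toLpLin, Matrix.toLin'_apply, augmented, Matrix.fromBlocks_mulVec]
  rcases i with i | i
  · simp [stack, upper, lower, Matrix.neg_mulVec, Matrix.smul_mulVec, Function.comp_def]
    ring
  · simp [stack, upper, lower, Matrix.neg_mulVec, Matrix.smul_mulVec, Function.comp_def]
    ring

theorem isHermitian_projector (u : EuclideanSpace ℝ (Fin M)) (v : EuclideanSpace ℝ (Fin N)) :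
    (projector u v).IsHermitian := by
  refine Matrix.IsHermitian.fromBlocks ?_ (by simp) ?_
  · ext i j; simp [Matrix.vecMulVec_apply, Matrix.one_apply, mul_comm, eq_comm]
  · ext i j; simp [Matrix.vecMulVec_apply, Matrix.one_apply, mul_comm, eq_comm]

theorem isHermitian_augmented (A : Matrix (Fin M) (Fin N) ℝ) (τ : ℝ) :
    (augmented A τ).IsHermitian := by
  refine Matrix.IsHermitian.fromBlocks ?_ (by simp) ?_
  · simp [Matrix.IsHermitian]
  · simp [Matrix.IsHermitian]

theorem isSymmetric_correctionMatrix (A : Matrix (Fin M) (Fin N) ℝ) (τ : ℝ)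
    (u : EuclideanSpace ℝ (Fin M)) (v : EuclideanSpace ℝ (Fin N)) :
    (Matrix.toEuclideanLin (correctionMatrix A τ u v)).IsSymmetric := by
  rw [Matrix.isSymmetric_toEuclideanLin_iff, correctionMatrix, Matrix.IsHermitian,
    Matrix.conjTranspose_mul, Matrix.conjTranspose_mul, isHermitian_projector,
    isHermitian_augmented, Matrix.mul_assoc]

theorem toEuclideanLin_mul_apply {ι : Type*} [Fintype ι] [DecidableEq ι] (B C : Matrix ι ι ℝ)
    (x : EuclideanSpace ℝ ι) :
    Matrix.toEuclideanLin (B * C) x = Matrix.toEuclideanLin B (Matrix.toEuclideanLin C x) := by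
  ext i
  simp

theorem toEuclideanLin_projector_of_mem {u : EuclideanSpace ℝ (Fin M)}
    {v : EuclideanSpace ℝ (Fin N)} {x : EuclideanSpace ℝ (Fin M ⊕ Fin N)}
    (hx : x ∈ biPerpSubmodule u v) : Matrix.toEuclideanLin (projector u v) x = x := by
  rw [mem_biPerpSubmodule] at hx
  rw [toEuclideanLin_projector, hx.1, hx.2, zero_smul, zero_smul, sub_zero, sub_zero,
    stack_upper_lower]

theorem correctionMatrix_mem {A : Matrix (Fin M) (Fin N) ℝ} {τ : ℝ}
    {u : EuclideanSpace ℝ (Fin M)} {v : EuclideanSpace ℝ (Fin N)} (hu : ‖u‖ = 1) (hv : ‖v‖ = 1)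
    (x : EuclideanSpace ℝ (Fin M ⊕ Fin N)) :
    Matrix.toEuclideanLin (correctionMatrix A τ u v) x ∈ biPerpSubmodule u v := by
  rw [correctionMatrix, Matrix.mul_assoc, toEuclideanLin_mul_apply, toEuclideanLin_projector,
    mem_biPerpSubmodule, upper_stack, lower_stack]
  simp [inner_sub_right, inner_smul_right, hu, hv]

/-- Between doubly orthogonal vectors the projectors drop out, so the eigenvalue equation becomes a
Galerkin condition on `A`. -/
theorem inner_correctionMatrix {A : Matrix (Fin M) (Fin N) ℝ} {τ : ℝ}
    {u : EuclideanSpace ℝ (Fin M)} {v : EuclideanSpace ℝ (Fin N)}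
    {x y : EuclideanSpace ℝ (Fin M ⊕ Fin N)} (hx : x ∈ biPerpSubmodule u v)
    (hy : y ∈ biPerpSubmodule u v) :
    inner ℝ y (Matrix.toEuclideanLin (correctionMatrix A τ u v) x) =
      inner ℝ (upper y) (Matrix.toEuclideanLin A (lower x)) +
      inner ℝ (lower y) (Matrix.toEuclideanLin A.transpose (upper x)) - τ * inner ℝ y x := by
  have hP := Matrix.isSymmetric_toEuclideanLin_iff.2 (isHermitian_projector u v)
  rw [correctionMatrix, Matrix.mul_assoc, toEuclideanLin_mul_apply, ← hP,
    toEuclideanLin_projector_of_mem hy, toEuclideanLin_mul_apply,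
    toEuclideanLin_projector_of_mem hx, toEuclideanLin_augmented, inner_eq_upper_add_lower,
    inner_eq_upper_add_lower y x]
  simp only [upper_stack, lower_stack, inner_sub_right, inner_smul_right]
  ring

end Blocks

/-! ### Extreme singular values -/

section Sorted

variable {N : ℕ} {σ : Fin N → ℝ} (hN : 2 ≤ N)

theorem monotone_ascending (σ : Fin N → ℝ) : Monotone (ascending σ) := Tuple.monotone_sort σ

theorem le_sigmaMax (i : Fin N) : σ i ≤ sigmaMax hN σ := by
  obtain ⟨k, rfl⟩ := (Tuple.sort σ).surjective i
  exact monotone_ascending σ (Fin.le_def.2 (by simp only; omega))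

theorem sigmaMin_le (i : Fin N) : sigmaMin hN σ ≤ σ i := by
  obtain ⟨k, rfl⟩ := (Tuple.sort σ).surjective i
  exact monotone_ascending σ (Fin.le_def.2 (by simp))

theorem exists_sigmaMin_eq (σ : Fin N → ℝ) : ∃ i, sigmaMin hN σ = σ i := ⟨_, rfl⟩

/-- A value taken only once determines its index, so when `σ i₀` is extreme, the second extreme
value is attained away from `i₀`. -/
theorem sort_eq_of_ascending_eq {i₀ k : Fin N} (h : σ i₀ = ascending σ k)
    (hne : ∀ i, i ≠ i₀ → σ i ≠ σ i₀) : Tuple.sort σ k = i₀ := by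
  by_contra hk
  exact hne _ hk h.symm

theorem le_sigmaMax2 {i₀ i : Fin N} (h : σ i₀ = sigmaMax hN σ)
    (hne : ∀ i, i ≠ i₀ → σ i ≠ σ i₀) (hi : i ≠ i₀) : σ i ≤ sigmaMax2 hN σ := by
  have hs := sort_eq_of_ascending_eq h hne
  obtain ⟨k, rfl⟩ := (Tuple.sort σ).surjective i
  refine monotone_ascending σ (Fin.le_def.2 ?_)
  have : k ≠ ⟨N - 1, by omega⟩ := by rintro rfl; exact hi hs
  have : (k : ℕ) ≠ N - 1 := fun h => this (Fin.ext h)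
  simp only; omega

theorem exists_sigmaMax2_eq {i₀ : Fin N} (h : σ i₀ = sigmaMax hN σ)
    (hne : ∀ i, i ≠ i₀ → σ i ≠ σ i₀) : ∃ i, i ≠ i₀ ∧ sigmaMax2 hN σ = σ i := by
  refine ⟨_, fun hi => ?_, rfl⟩
  have := (Tuple.sort σ).injective (hi.trans (sort_eq_of_ascending_eq h hne).symm)
  rw [Fin.mk.injEq] at this
  omega

theorem sigmaMin2_le {i₀ i : Fin N} (h : σ i₀ = sigmaMin hN σ)
    (hne : ∀ i, i ≠ i₀ → σ i ≠ σ i₀) (hi : i ≠ i₀) : sigmaMin2 hN σ ≤ σ i := by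
  have hs := sort_eq_of_ascending_eq h hne
  obtain ⟨k, rfl⟩ := (Tuple.sort σ).surjective i
  refine monotone_ascending σ (Fin.le_def.2 ?_)
  have : k ≠ ⟨0, by omega⟩ := by rintro rfl; exact hi hs
  have : (k : ℕ) ≠ 0 := fun h => this (Fin.ext h)
  simp only; omega

theorem exists_sigmaMin2_eq {i₀ : Fin N} (h : σ i₀ = sigmaMin hN σ)
    (hne : ∀ i, i ≠ i₀ → σ i ≠ σ i₀) : ∃ i, i ≠ i₀ ∧ sigmaMin2 hN σ = σ i := by
  refine ⟨_, fun hi => ?_, rfl⟩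
  have := (Tuple.sort σ).injective (hi.trans (sort_eq_of_ascending_eq h hne).symm)
  rw [Fin.mk.injEq] at this
  omega

end Sorted

/-! ### Eigenvalues of the correction matrix -/

theorem sin_acuteAngle {n : ℕ} {x y : EuclideanSpace ℝ (Fin n)} (hx : ‖x‖ = 1) (hy : ‖y‖ = 1) :
    Real.sin (acuteAngle x y) = √(1 - inner ℝ y x ^ 2) := by
  rw [acuteAngle, Real.sin_arccos, hx, hy, mul_one, div_one, sq_abs, real_inner_comm]

/-- An eigenvector of the restricted coefficient matrix yields an approximate singular triplet of
`A` that is orthogonal to the chosen left and right singular vectors. -/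
theorem exists_approx_of_eigenvector {M N : ℕ} {hMN : N ≤ M} {A : Matrix (Fin M) (Fin N) ℝ}
    {e : OrthonormalBasis (Fin M) ℝ (EuclideanSpace ℝ (Fin M))}
    {f : OrthonormalBasis (Fin N) ℝ (EuclideanSpace ℝ (Fin N))} {σ : Fin N → ℝ}
    (h : IsSingularBasis hMN (Matrix.toEuclideanLin A) (Matrix.toEuclideanLin A.transpose) e f σ)
    (j₀ : Fin N) {u : EuclideanSpace ℝ (Fin M)} {v : EuclideanSpace ℝ (Fin N)}
    (hu : ‖u‖ = 1) (hv : ‖v‖ = 1) {δ : ℝ}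
    (hδ : δ = ‖A‖ * (√(1 - inner ℝ (e (Fin.castLE hMN j₀)) u ^ 2) +
      √(1 - inner ℝ (f j₀) v ^ 2)) ^ 2) {τ μ : ℝ}
    {x : EuclideanSpace ℝ (Fin M ⊕ Fin N)} (hx : x ∈ biPerpSubmodule u v) (hx0 : x ≠ 0)
    (hμ : Matrix.toEuclideanLin (correctionMatrix A τ u v) x = (μ - τ) • x) :
    ∃ y z, inner ℝ (e (Fin.castLE hMN j₀)) y = 0 ∧ inner ℝ (f j₀) z = 0 ∧
      0 < ‖y‖ ^ 2 + ‖z‖ ^ 2 ∧ (μ ≠ 0 → ‖y‖ = ‖z‖) ∧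
      ‖Matrix.toEuclideanLin A z - μ • y‖ ≤ δ * ‖z‖ ∧
      ‖Matrix.toEuclideanLin A.transpose y - μ • z‖ ≤ δ * ‖y‖ := by
  -- The rotations need nonnegative inner products, while the angles only see lines. The signs of
  -- the singular vectors are flipped accordingly, which may flip the sign of the singular value.
  have hsign : ∀ t : ℝ, ∃ ε : ℝ, (ε = 1 ∨ ε = -1) ∧ 0 ≤ ε * t := by
    intro t
    rcases le_total 0 t with ht | ht
    · exact ⟨1, .inl rfl, by linarith⟩
    · exact ⟨-1, .inr rfl, by linarith⟩
  have hsq : ∀ ε : ℝ, ε = 1 ∨ ε = -1 → ε * ε = 1 ∧ |ε| = 1 ∧ ε ≠ 0 := by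
    rintro ε (rfl | rfl) <;> norm_num
  obtain ⟨ε, hε, hεu⟩ := hsign (inner ℝ (e (Fin.castLE hMN j₀)) u)
  obtain ⟨ε', hε', hεv⟩ := hsign (inner ℝ (f j₀) v)
  obtain ⟨hεε, hεabs, hε0⟩ := hsq ε hε
  obtain ⟨hεε', hεabs', hε0'⟩ := hsq ε' hε'
  have hab : 0 ≤ inner ℝ (ε • e (Fin.castLE hMN j₀)) u := by
    rwa [inner_smul_left]
  have hab' : 0 ≤ inner ℝ (ε' • f j₀) v := by
    rwa [inner_smul_left]
  have ha : ‖ε • e (Fin.castLE hMN j₀)‖ = 1 := by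
    rw [norm_smul, Real.norm_eq_abs, hεabs, e.orthonormal.1, mul_one]
  have ha' : ‖ε' • f j₀‖ = 1 := by
    rw [norm_smul, Real.norm_eq_abs, hεabs', f.orthonormal.1, mul_one]
  have hTa : Matrix.toEuclideanLin A (ε' • f j₀) =
      (ε * ε' * σ j₀) • ε • e (Fin.castLE hMN j₀) := by
    rw [map_smul, h.map_right, smul_smul, smul_smul]
    congr 1
    linear_combination -(ε' * σ j₀) * hεε
  have hTa' : Matrix.toEuclideanLin A.transpose (ε • e (Fin.castLE hMN j₀)) =
      (ε * ε' * σ j₀) • ε' • f j₀ := by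
    rw [map_smul, h.map_left, smul_smul, smul_smul]
    congr 1
    linear_combination -(ε * σ j₀) * hεε'
  have hAnorm : ∀ z, ‖Matrix.toEuclideanLin A z‖ ≤ ‖A‖ * ‖z‖ := fun z =>
    Matrix.l2_opNorm_mulVec A z
  have hδ0 : 0 ≤ δ := by rw [hδ]; positivity
  have hpert : ∀ y z, inner ℝ (ε • e (Fin.castLE hMN j₀)) y = 0 → inner ℝ (ε' • f j₀) z = 0 →
      |inner ℝ (rotate (ε • e (Fin.castLE hMN j₀)) u y)
        (Matrix.toEuclideanLin A (rotate (ε' • f j₀) v z)) -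
        inner ℝ y (Matrix.toEuclideanLin A z)| ≤ δ * ‖y‖ * ‖z‖ := by
    intro y z hy hz
    have := abs_inner_rotate_sub_le h.adjoint hAnorm ha hu ha' hv hab hab' hTa hTa' hy hz
    rw [hδ]
    rw [inner_smul_left (𝕜 := ℝ) (e _), inner_smul_left (𝕜 := ℝ) (f _), mul_pow, mul_pow] at this
    simpa only [conj_trivial, pow_two ε, pow_two ε', hεε, hεε', one_mul] using this
  have hxp := mem_biPerpSubmodule.1 hx
  have hL : ∀ y ∈ biPerpSubmodule u v, inner ℝ (upper y) (Matrix.toEuclideanLin A (lower x)) +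
      inner ℝ (lower y) (Matrix.toEuclideanLin A.transpose (upper x)) =
      μ * (inner ℝ (upper y) (upper x) + inner ℝ (lower y) (lower x)) := by
    intro y hy
    have := inner_correctionMatrix (A := A) (τ := τ) hx hy
    rw [hμ, inner_smul_right, inner_eq_upper_add_lower] at this
    linarith
  have h1 : ∀ y, inner ℝ u y = 0 → inner ℝ y (Matrix.toEuclideanLin A (lower x)) =
      μ * inner ℝ y (upper x) := by
    intro y hy
    simpa using hL (stack y 0) (by rw [mem_biPerpSubmodule]; simpa using hy)
  have h2 : ∀ z, inner ℝ v z = 0 → inner ℝ z (Matrix.toEuclideanLin A.transpose (upper x)) =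
      μ * inner ℝ z (lower x) := by
    intro z hz
    simpa using hL (stack 0 z) (by rw [mem_biPerpSubmodule]; simpa using hz)
  obtain ⟨y, z, hy, hz, hny, hnz, hr1, hr2⟩ := exists_approx_singular_triplet h.adjoint hδ0 ha hu
    ha' hv hab hab' hTa hTa' hpert hxp.1 hxp.2 h1 h2
  refine ⟨y, z, ?_, ?_, ?_, ?_, hr1, hr2⟩
  · rw [inner_smul_left] at hy
    exact (mul_eq_zero.1 hy).resolve_left hε0
  · rw [inner_smul_left] at hz
    exact (mul_eq_zero.1 hz).resolve_left hε0'
  · have := inner_eq_upper_add_lower x x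
    rw [real_inner_self_eq_norm_sq, real_inner_self_eq_norm_sq, real_inner_self_eq_norm_sq] at this
    rw [hny, hnz, ← this]
    have := norm_pos_iff.2 hx0
    positivity
  · intro hμ0
    -- Testing with the two halves of `x` evaluates `⟪upper x, A (lower x)⟫` both as `μ ‖upper x‖²`
    -- and as `μ ‖lower x‖²`.
    have e1 := h1 _ hxp.1
    have e2 := h2 _ hxp.2
    rw [h.adjoint, real_inner_comm, e2, real_inner_self_eq_norm_sq,
      real_inner_self_eq_norm_sq] at e1
    rw [hny, hnz]
    exact ((sq_eq_sq₀ (norm_nonneg _) (norm_nonneg _)).1 (mul_left_cancel₀ hμ0 e1)).symm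

theorem norm_innerResidual_div_le {M N : ℕ} {A : Matrix (Fin M) (Fin N) ℝ} {τ : ℝ}
    {u : EuclideanSpace ℝ (Fin M)} {v : EuclideanSpace ℝ (Fin N)} (hu : ‖u‖ = 1) (hv : ‖v‖ = 1)
    {r w : EuclideanSpace ℝ (Fin M ⊕ Fin N)} (hr0 : r ≠ 0) (hr : BiPerp r u v) {j : ℕ}
    (hw : IsMinresIterate (correctionMatrix A τ u v) (-r) j w) {p : ℝ[X]} (hp : p.natDegree ≤ j)
    (hp0 : p.eval 0 = 1) {c : ℝ}
    (hc : ∀ μ : ℝ, ∀ x ∈ biPerpSubmodule u v, x ≠ 0 →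
      Matrix.toEuclideanLin (correctionMatrix A τ u v) x = (μ - τ) • x → |p.eval (μ - τ)| ≤ c) :
    ‖innerResidual A τ u v r w‖ / ‖r‖ ≤ c := by
  rw [div_le_iff₀ (norm_pos_iff.2 hr0)]
  refine (hw.norm_residual_le hp hp0).trans ?_
  refine norm_aeval_le_of_eigenvalues_of_invariant (isSymmetric_correctionMatrix A τ u v)
    (S := biPerpSubmodule u v) (fun x _ => correctionMatrix_mem hu hv x) p
    (fun l x hx hx0 h => ?_) hr
  have := hc (l + τ) x hx hx0 (by rwa [add_sub_cancel_right])
  rwa [add_sub_cancel_right] at this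

theorem norm_pos_of_sq_add_pos {E F : Type*} [NormedAddCommGroup E] [NormedAddCommGroup F]
    {y : E} {z : F} (h : 0 < ‖y‖ ^ 2 + ‖z‖ ^ 2) (hyz : ‖y‖ = ‖z‖) : 0 < ‖z‖ := by
  rw [hyz] at h
  refine (norm_nonneg z).lt_of_ne fun h0 => ?_
  rw [← h0] at h
  norm_num at h

/-! ### Residual polynomials for the three spectral shapes -/

/-- The residual polynomial for a spectrum on one side of the origin. -/
theorem exists_residual_polynomial_neg (j : ℕ) {a b : ℝ} (ha : 0 < a) (hab : a ≤ b) :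
    ∃ p : ℝ[X], p.natDegree ≤ j ∧ p.eval 0 = 1 ∧
      ∀ t, -b ≤ t → t ≤ -a → |p.eval t| ≤ 2 * (1 - 2 / (1 + √(b / a))) ^ j := by
  obtain ⟨q, hq, hq0, hqt⟩ := exists_residual_polynomial j ha hab
  refine ⟨q.comp (-X), natDegree_comp_le.trans (by simpa using hq), by simp [hq0], ?_⟩
  intro t h1 h2
  simpa using hqt (-t) (by linarith) (by linarith)

/-- The residual polynomial for a spectrum in two intervals of equal length, symmetric about the
origin. -/
theorem exists_residual_polynomial_abs (j : ℕ) {a b : ℝ} (ha : 0 < a) (hab : a ≤ b) :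
    ∃ p : ℝ[X], p.natDegree ≤ j ∧ p.eval 0 = 1 ∧
      ∀ t, a ≤ |t| → |t| ≤ b → |p.eval t| ≤ 2 * (1 - 2 / (1 + b / a)) ^ (j / 2) := by
  obtain ⟨q, hq, hq0, hqt⟩ := exists_residual_polynomial (j / 2) (pow_pos ha 2)
    (pow_le_pow_left₀ ha.le hab 2)
  refine ⟨q.comp (X ^ 2), natDegree_comp_le.trans ?_, by simp [hq0], ?_⟩
  · rw [natDegree_X_pow]; omega
  · intro t h1 h2
    have := hqt (t ^ 2) (by rw [← sq_abs t]; gcongr) (by rw [← sq_abs t]; gcongr)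
    rw [← div_pow, Real.sqrt_sq (div_nonneg (ha.le.trans hab) ha.le)] at this
    simpa using this

/-- The residual polynomial for a spectrum in two intervals of equal length, symmetric about `-τ`,
and, if `d = 1`, the point `-τ` itself. -/
theorem exists_residual_polynomial_shifted (j : ℕ) {d : ℕ} {τ a b : ℝ} (hτ : 0 ≤ τ)
    (hd : d = 0 ∨ (d = 1 ∧ 0 < τ)) (ha : τ < a) (hab : a ≤ b) :
    ∃ p : ℝ[X], p.natDegree ≤ j ∧ p.eval 0 = 1 ∧
      ∀ μ, ((d = 1 ∧ μ = 0) ∨ a ≤ |μ|) → |μ| ≤ b →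
        |p.eval (μ - τ)| ≤ 2 * (b / τ) ^ d *
          (1 - 2 / (1 + √((b ^ 2 - τ ^ 2) / (a ^ 2 - τ ^ 2)))) ^ ((j - d) / 2) := by
  have ha0 : 0 < a := hτ.trans_lt ha
  have haτ : 0 < a ^ 2 - τ ^ 2 := by nlinarith
  have hbτ : a ^ 2 - τ ^ 2 ≤ b ^ 2 - τ ^ 2 := by nlinarith
  -- When `j = 0` and `d = 1` there is no degree left for the extra factor; `p = 1` works because `1
  -- ≤ b / τ`.
  rcases Nat.lt_or_ge j d with hjd | hjd
  · obtain ⟨rfl, hτ0⟩ : d = 1 ∧ 0 < τ := hd.resolve_left (by omega)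
    refine ⟨1, by simp, by simp, fun μ _ _ => ?_⟩
    have : 1 ≤ b / τ := by rw [le_div_iff₀ hτ0]; linarith
    rw [show (j - 1) / 2 = 0 by omega]
    simp
    linarith
  obtain ⟨q, hq, hq0, hqt⟩ := exists_residual_polynomial ((j - d) / 2) haτ hbτ
  -- At `t = μ - τ` the inner polynomial is `μ² - τ²`, folding the intervals together, and `1 + t /
  -- τ = μ / τ` vanishes at `μ = 0`. For `d = 0` this factor is 1, even when `τ = 0`.
  refine ⟨q.comp ((X + C τ) ^ 2 - C (τ ^ 2)) * (1 + C τ⁻¹ * X) ^ d, ?_, ?_, ?_⟩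
  · refine natDegree_mul_le.trans ?_
    have h1 : (q.comp ((X + C τ) ^ 2 - C (τ ^ 2))).natDegree ≤ (j - d) / 2 * 2 := by
      refine natDegree_comp_le.trans (Nat.mul_le_mul hq ?_)
      compute_degree
    have h2 : ((1 + C τ⁻¹ * X : ℝ[X]) ^ d).natDegree ≤ d * 1 := by
      refine natDegree_pow_le.trans (Nat.mul_le_mul_left d ?_)
      compute_degree
    omega
  · simp [hq0]
  · intro μ hμ hμb
    have hev : (q.comp ((X + C τ) ^ 2 - C (τ ^ 2)) * (1 + C τ⁻¹ * X) ^ d).eval (μ - τ) =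
        q.eval (μ ^ 2 - τ ^ 2) * (1 + τ⁻¹ * (μ - τ)) ^ d := by
      simp
    rw [hev, abs_mul, abs_pow]
    have hfac : |1 + τ⁻¹ * (μ - τ)| ^ d = (|μ| / τ) ^ d := by
      rcases hd with rfl | ⟨rfl, hτ0⟩
      · simp
      · rw [show 1 + τ⁻¹ * (μ - τ) = μ / τ by field_simp; ring, abs_div, abs_of_pos hτ0]
    rw [hfac]
    have hb0 : 0 ≤ b / τ := div_nonneg (by linarith) hτ
    have hκ : 0 ≤ 1 - 2 / (1 + √((b ^ 2 - τ ^ 2) / (a ^ 2 - τ ^ 2))) := by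
      have : 1 ≤ √((b ^ 2 - τ ^ 2) / (a ^ 2 - τ ^ 2)) := by
        rw [Real.one_le_sqrt, le_div_iff₀ haτ]; linarith
      rw [sub_nonneg, div_le_one (by linarith)]
      linarith
    rcases hμ with ⟨rfl, rfl⟩ | hμ
    · simp only [abs_zero, zero_div, pow_one, mul_zero]
      positivity
    · have h1 := hqt (μ ^ 2 - τ ^ 2)
        (by rw [← sq_abs μ]; gcongr)
        (by rw [← sq_abs μ]; gcongr)
      calc _ ≤ 2 * (1 - 2 / (1 + √((b ^ 2 - τ ^ 2) / (a ^ 2 - τ ^ 2)))) ^ ((j - d) / 2) *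
            (b / τ) ^ d := by gcongr
        _ = _ := by ring

end JDSVD

end

/-! ### The three bounds -/

theorem theorem5 {M N : ℕ} (hN : 2 ≤ N) (hMN : N ≤ M)
    (A : Matrix (Fin M) (Fin N) ℝ) (U : Matrix (Fin M) (Fin M) ℝ)
    (σ : Fin N → ℝ) (V : Matrix (Fin N) (Fin N) ℝ) (hsvd : JDSVD.IsSVD A U σ V)
    (τ : ℝ) (hτ : 0 ≤ τ) (hτσ : ∀ i, τ ≠ σ i)
    (hlabel : Monotone fun i => |σ i - τ|)
    (hstrict : |σ ⟨0, by omega⟩ - τ| < |σ ⟨1, by omega⟩ - τ|)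
    (u : EuclideanSpace ℝ (Fin M)) (v : EuclideanSpace ℝ (Fin N))
    (hu : ‖u‖ = 1) (hv : ‖v‖ = 1)
    (φ ψ δ : ℝ)
    (hφ : φ = JDSVD.acuteAngle u (JDSVD.column U ⟨0, by omega⟩))
    (hψ : ψ = JDSVD.acuteAngle v (JDSVD.column V ⟨0, by omega⟩))
    (hδ : δ = ‖A‖ * (Real.sin φ + Real.sin ψ) ^ 2)
    (hδσ : δ < |σ ⟨1, by omega⟩ - τ|)
    (r : EuclideanSpace ℝ (Fin M ⊕ Fin N)) (hr0 : r ≠ 0) (hr : JDSVD.BiPerp r u v)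
    (w : ℕ → EuclideanSpace ℝ (Fin M ⊕ Fin N))
    (hw : ∀ j, JDSVD.IsMinresIterate (JDSVD.correctionMatrix A τ u v) (-r) j (w j)) :
    (σ ⟨0, by omega⟩ = JDSVD.sigmaMax hN σ → ∀ j : ℕ,
      ‖JDSVD.innerResidual A τ u v r (w j)‖ / ‖r‖ ≤
        2 * (1 - 2 / (1 + √((τ + JDSVD.sigmaMax2 hN σ + δ) /
          (τ - JDSVD.sigmaMax2 hN σ - δ)))) ^ j) ∧
    (σ ⟨0, by omega⟩ = JDSVD.sigmaMin hN σ → (0 < τ ∨ M = N) → ∀ j : ℕ,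
      ‖JDSVD.innerResidual A τ u v r (w j)‖ / ‖r‖ ≤
        2 * ((JDSVD.sigmaMax hN σ + δ) / τ) ^ (min 1 (M - N)) *
          (1 - 2 / (1 + √(((JDSVD.sigmaMax hN σ + δ) ^ 2 - τ ^ 2) /
            ((JDSVD.sigmaMin2 hN σ - δ) ^ 2 - τ ^ 2)))) ^ ((j - min 1 (M - N)) / 2)) ∧
    (σ ⟨0, by omega⟩ ≠ JDSVD.sigmaMax hN σ → σ ⟨0, by omega⟩ ≠ JDSVD.sigmaMin hN σ → ∀ j : ℕ,
      ‖JDSVD.innerResidual A τ u v r (w j)‖ / ‖r‖ ≤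
        2 * (1 - 2 / (1 + (JDSVD.sigmaMax hN σ + τ + δ) /
          (|σ ⟨1, by omega⟩ - τ| - δ))) ^ (j / 2)) := by
  have hB := hsvd.isSingularBasis hMN
  have hσ := hsvd.nonneg
  have hδ0 : 0 ≤ δ := by rw [hδ]; positivity
  have hle : ∀ i, i ≠ ⟨0, by omega⟩ → |σ ⟨1, by omega⟩ - τ| ≤ |σ i - τ| := by
    intro i hi
    refine hlabel (Fin.le_def.2 ?_)
    have : (i : ℕ) ≠ 0 := fun h => hi (Fin.ext h)
    simp only; omega
  have hlt : ∀ i, i ≠ ⟨0, by omega⟩ → |σ ⟨0, by omega⟩ - τ| < |σ i - τ| :=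
    fun i hi => hstrict.trans_le (hle i hi)
  have hne : ∀ i, i ≠ ⟨0, by omega⟩ → σ i ≠ σ ⟨0, by omega⟩ := by
    intro i hi h
    exact absurd (hlt i hi) (by rw [h]; exact lt_irrefl _)
  have hδ' : δ = ‖A‖ * (√(1 - inner ℝ (JDSVD.columnBasis hsvd.left_orthogonal
      (Fin.castLE hMN ⟨0, by omega⟩)) u ^ 2) +
      √(1 - inner ℝ (JDSVD.columnBasis hsvd.right_orthogonal ⟨0, by omega⟩) v ^ 2)) ^ 2 := by
    rw [hδ, hφ, hψ, JDSVD.sin_acuteAngle hu ((JDSVD.orthonormal_column hsvd.left_orthogonal).1 _),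
      JDSVD.sin_acuteAngle hv ((JDSVD.orthonormal_column hsvd.right_orthogonal).1 _),
      JDSVD.columnBasis_apply, JDSVD.columnBasis_apply]
    rfl
  have happrox := fun μ x hx hx0 h =>
    JDSVD.exists_approx_of_eigenvector hB ⟨0, by omega⟩ hu hv hδ' (τ := τ) (μ := μ) (x := x) hx hx0 h
  have hbound := fun j p hp hp0 c hc =>
    JDSVD.norm_innerResidual_div_le hu hv hr0 hr (hw j) (p := p) hp hp0 (c := c) hc
  have hupper : ∀ K, 0 ≤ K → (∀ j, j ≠ ⟨0, by omega⟩ → σ j ≤ K) →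
      ∀ μ : ℝ, ∀ x ∈ JDSVD.biPerpSubmodule u v, x ≠ 0 →
        Matrix.toEuclideanLin (JDSVD.correctionMatrix A τ u v) x = (μ - τ) • x → |μ| ≤ K + δ := by
    intro K hK0 hK μ x hx hx0 h
    obtain ⟨y, z, hy, hz, hpos, hyz, h1, h2⟩ := happrox μ x hx hx0 h
    by_cases hμ : μ = 0
    · rw [hμ, abs_zero]; positivity
    exact JDSVD.abs_le_of_approx (JDSVD.norm_pos_of_sq_add_pos hpos (hyz hμ)) (hyz hμ)
      (hB.norm_map_le (fun j hj => by rw [abs_of_nonneg (hσ j)]; exact hK j hj) hK0 hz) h1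
  refine ⟨fun hmax j => ?_, fun hmin hM j => ?_, fun hmax hmin j => ?_⟩
  · obtain ⟨i, hi, hi2⟩ := JDSVD.exists_sigmaMax2_eq hN hmax hne
    -- A singular value in `[τ, σ₁]` would be at least as close to `τ` as `σ₁`.
    have hlt2 : σ i < τ := by
      by_contra! hτi
      have h1 := hlt i hi
      have h2 := JDSVD.le_sigmaMax hN (σ := σ) i
      rw [← hmax] at h2
      rw [abs_of_nonneg (by linarith), abs_of_nonneg (by linarith)] at h1
      linarith
    have hgap : δ < τ - σ i := by
      have := hδσ.trans_le (hle i hi)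
      rwa [abs_of_neg (by linarith), neg_sub] at this
    rw [hi2]
    obtain ⟨p, hp, hp0, hpt⟩ := JDSVD.exists_residual_polynomial_neg j (a := τ - σ i - δ)
      (b := τ + σ i + δ) (by linarith) (by linarith [hσ i])
    refine hbound j p hp hp0 _ fun μ x hx hx0 h => ?_
    have hμ := abs_le.1 (hupper (σ i) (hσ i)
      (fun k hk => hi2 ▸ JDSVD.le_sigmaMax2 hN hmax hne hk) μ x hx hx0 h)
    exact hpt _ (by linarith) (by linarith)
  · obtain ⟨i, hi, hi2⟩ := JDSVD.exists_sigmaMin2_eq hN hmin hne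
    have hlt2 : τ < σ i := by
      by_contra! hτi
      have h1 := hlt i hi
      have h2 := JDSVD.sigmaMin_le hN (σ := σ) i
      rw [← hmin] at h2
      rw [abs_of_nonpos (by linarith), abs_of_nonpos (by linarith)] at h1
      linarith
    have hgap : τ < σ i - δ := by
      have := hδσ.trans_le (hle i hi)
      rw [abs_of_pos (by linarith)] at this
      linarith
    have hk : ∀ k, k ≠ ⟨0, by omega⟩ → σ i ≤ σ k :=
      fun k hk => hi2 ▸ JDSVD.sigmaMin2_le hN hmin hne hk
    rw [hi2]
    obtain ⟨p, hp, hp0, hpt⟩ := JDSVD.exists_residual_polynomial_shifted j (d := min 1 (M - N))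
      (a := σ i - δ) (b := JDSVD.sigmaMax hN σ + δ) hτ (by
        rcases hM with hM | hM
        · rcases Nat.eq_zero_or_pos (M - N) with h0 | h0
          · left; omega
          · right; exact ⟨by omega, hM⟩
        · left; omega) hgap (by linarith [JDSVD.le_sigmaMax hN (σ := σ) i])
    refine hbound j p hp hp0 _ fun μ x hx hx0 h => hpt μ ?_ (hupper _
      ((hσ i).trans (JDSVD.le_sigmaMax hN i)) (fun k _ => JDSVD.le_sigmaMax hN k) μ x hx hx0 h)
    obtain ⟨y, z, hy, hz, hpos, hyz, h1, h2⟩ := happrox μ x hx hx0 h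
    -- The lower bound on `A` forces `z = 0` when `μ = 0`; for `M = N` the same holds for `Aᵀ` and
    -- `y`, so this eigenvalue arises only if `M > N`.
    by_cases hμ : μ = 0
    · left
      refine ⟨?_, hμ⟩
      subst hμ
      have hδi : δ < σ i := by linarith
      have hz0 := JDSVD.eq_zero_of_approx hδi (hB.le_norm_map hk (hσ i) hz) h1
      by_contra hMN'
      obtain rfl : M = N := by omega
      have hy0 := JDSVD.eq_zero_of_approx hδi (hB.symm.le_norm_map hk (hσ i) hy) h2
      rw [hz0, hy0] at hpos
      simp at hpos
    · right
      exact JDSVD.le_abs_of_approx (JDSVD.norm_pos_of_sq_add_pos hpos (hyz hμ)) (hyz hμ)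
        (hB.le_norm_map hk (hσ i) hz) h1
  · obtain ⟨m, hm⟩ := JDSVD.exists_sigmaMin_eq hN σ
    have hm0 : m ≠ ⟨0, by omega⟩ := by rintro rfl; exact hmin hm.symm
    -- The smallest singular value must lie on the far side of `τ` from `σ₁`. Being nonnegative, it
    -- shows that the gap is at most `τ`, so unpaired left singular vectors do no harm.
    have hmτ : σ m < τ := by
      by_contra! hτm
      have h1 := hlt m hm0
      have h2 := JDSVD.sigmaMin_le hN (σ := σ) ⟨0, by omega⟩
      rw [hm] at h2
      rw [abs_of_nonneg (by linarith), abs_of_nonneg (by linarith)] at h1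
      linarith
    have hgτ : |σ ⟨1, by omega⟩ - τ| ≤ τ := by
      have := hle m hm0
      rw [abs_of_neg (a := σ m - τ) (by linarith)] at this
      linarith [hσ m]
    have hmax0 : 0 ≤ JDSVD.sigmaMax hN σ := (hσ m).trans (JDSVD.le_sigmaMax hN m)
    obtain ⟨p, hp, hp0, hpt⟩ := JDSVD.exists_residual_polynomial_abs j
      (a := |σ ⟨1, by omega⟩ - τ| - δ) (b := JDSVD.sigmaMax hN σ + τ + δ) (by linarith)
      (by linarith)
    refine hbound j p hp hp0 _ fun μ x hx hx0 h => hpt _ ?_ ?_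
    · obtain ⟨y, z, hy, hz, hpos, hyz, h1, h2⟩ := happrox μ x hx hx0 h
      exact JDSVD.le_abs_sub_of_approx hB hσ hτ hδ0 hδσ.le hgτ hle hy hz hpos h1 h2
    · have := hupper _ hmax0 (fun k _ => JDSVD.le_sigmaMax hN k) μ x hx hx0 h
      rw [abs_le] at this ⊢
      constructor <;> linarith
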